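/- **Setting.** Let $\mathbf k$ be a commutative unitary ring, $\lambda\in\mathbf k$, $n\ge 0$ an integer and $X$ a well-ordered set. Let $\Delta_nX=\{x^{(i)}: x\in X,\ 0\le i\le n\}$ and let $C(\Delta_nX)$ be the free commutative monoid on it. A *DRB monomial of order $n$* is a tensor $u_0\otimes u_1\otimes\cdots\otimes u_k$ with $k\ge 0$, $u_i\in C(\Delta_nX)$; the set of these is $\mathfrak B=\mathfrak B(\Delta_nX)$. On the free module $\mathbf k\mathfrak B$ put the commutative product $(a_0\otimes a)(b_0\otimes b)=a_0b_0\otimes(a\ast b)$, with $\ast$ the mixable shuffle product of weight $\lambda$ (the empty tensor is its unit, and $(a_1\otimes a')\ast(b_1\otimes b')=a_1\otimes(a'\ast(b_1\otimes b'))+b_1\otimes((a_1\otimes a')\ast b')+\lambda\,a_1b_1\otimes(a'\ast b')$); the operator $P(u)=1\otimes u$; and the operator $d$ with $d(1)=0$, $d(x^{(i)})=x^{(i+1)}$ for $i<n$, $d(x^{(n)})=0$, $d(uv)=d(u)v+ud(v)+\lambda d(u)d(v)$ on $C(\Delta_nX)$, and $d(u_0\otimes u_1\otimes\cdots\otimes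 u_k)=d(u_0)\otimes u_1\otimes\cdots\otimes u_k+u_0u_1\otimes u_2\otimes\cdots\otimes u_k+\lambda\, d(u_0)u_1\otimes u_2\otimes\cdots\otimes u_k$ for $k\ge1$. This is the free commutative differential Rota–Baxter algebra of order $n$ on $X$. *Order.* Order $\Delta_nX$ by $x^{(i)}\le y^{(j)}$ iff $(x,-i)\le(y,-j)$ lexicographically; order $C(\Delta_nX)$ by length and then lexicographically, words being written with letters in non-increasing order; order $\mathfrak B$ by $u_0\otimes\cdots\otimes u_k\le_n v_0\otimes\cdots\otimes v_\ell$ iff $(k+1,u_0,\dots,u_k)\le(\ell+1,v_0,\dots,v_\ell)$ lexicographically. For $0\ne f\in\mathbf k\mathfrak B$ let $\bar f$ be its leading monomial; $f$ is *monic* if the coefficient of $\bar f$ is $1$. *Substitution.* Let $\mathfrak C(X)$ be the free commutative monoid with two operators $d,P$ on $X$, and embed $\mathfrak B$ in it by $u_0\otimes\cdots\otimes u_k\mapsto u_0P(u_1P(\cdots P(u_k)\cdots))$, $x^{(i)}\mapsto d^i(x)$. Let $\mathfrak B^\star$ be the set of DRB monomials of order $n$ on $X\sqcup\{\star\}$ with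 exactly one letter of the form $\star^{(\ell)}$. For $q\in\mathfrak B^\star$ and $u\in\mathfrak B$, $q|_u\in\mathfrak C(X)$ is obtained by replacing $\star$ by $u$ (so $\star^{(\ell)}$ becomes $d^\ell(u)$), and $q|_s=\sum c_iq|_{u_i}$ for $s=\sum c_iu_i$. In identities in $\mathbf k\mathfrak B$, $q|_s$ denotes its image under the homomorphism $\mathbf k\mathfrak C(X)\to\mathbf k\mathfrak B$ of algebras with operators $d,P$ that sends $x$ to $x^{(0)}$. For $s\neq 0$, $q|_s$ is *normal* if $q|_{\bar s}\in\mathfrak B$. *Compositions.* Let $S$ be a set of monic elements of $\mathbf k\mathfrak B$. Write $h\equiv0$ mod $[S]$ if $h=\sum_i c_iq_i|_{s_i}$ (a finite, possibly empty sum) with $c_i\in\mathbf k$, $s_i\in S$, $q_i\in\mathfrak B^\star$, $q_i|_{s_i}$ normal and $q_i|_{\bar s_i}\le_n\bar h$. Write $h\equiv0$ mod $(S,w)$ if the same holds with $\overline{q_i|_{s_i}}<_n w$ in place of the last condition. The *breadth* $\mathrm{bre}(u)$ of $u=u_0\otimes\cdots\otimes u_k$ is the length of $u_0$, plus $1$ if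 $k\ge 1$. $S$ is a *Gröbner–Shirshov basis* if for all $f,g\in S$: - (multiplication) if $\bar f\in C(\Delta_nX)P(\mathfrak B)$, then $fu\equiv 0$ mod $[S]$ for all $u\in C(\Delta_nX)P(\mathfrak B)$; - (derivation) for all $\ell\ge1$ such that $\bar f$ is not a letter $x^{(i)}$ with $i+\ell\le n$, $d^\ell(f)\equiv 0$ mod $[S]$; - (intersection) for all $u\in\mathfrak B$, $v\in C(\Delta_nX)$ and $w\in\mathfrak B$ with $w=\bar fu=v\bar g$ in $\mathfrak C(X)$ and $\mathrm{bre}(w)<\mathrm{bre}(\bar f)+\mathrm{bre}(\bar g)$, $fu-vg\equiv0$ mod $(S,w)$; - (inclusion) for all $q\in\mathfrak B^\star$ with $w:=\bar f=q|_{\bar g}$, $f-q|_g\equiv0$ mod $(S,w)$. Let $\mathrm{Id}(S)$ be the differential Rota–Baxter ideal generated by $S$, i.e. the smallest ideal of $\mathbf k\mathfrak B$ that contains $S$ and is closed under $d$ and $P$, and let $\mathrm{Irr}(S)=\mathfrak B\setminus\{q|_{\bar s}: q\in\mathfrak B^\star,\ s\in S,\ q|_s\text{ normal}\}$. **Theorem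 (Composition-Diamond Lemma).** For every set $S$ of monic elements of $\mathbf k\mathfrak B(\Delta_nX)$ the following are equivalent: - (a) $S$ is a Gröbner–Shirshov basis. - (b) For every $0\neq f\in\mathrm{Id}(S)$ there are $q\in\mathfrak B^\star$ and $s\in S$ with $q|_s$ normal and $\bar f=q|_{\bar s}$. - (c) The image of $\mathrm{Irr}(S)$ is a $\mathbf k$-basis of $\mathbf k\mathfrak B/\mathrm{Id}(S)$; in other words, $\mathbf k\,\mathrm{Irr}(S)\oplus\mathrm{Id}(S)=\mathbf k\mathfrak B$. -/

import Mathlib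

namespace DRB

/-! ### Differential Rota-Baxter monomials

A letter `(x, i) : X × Fin (n + 1)` of the alphabet `Δ_n X` stands for `x^{(i)}`, `0 ≤ i ≤ n`.
The free commutative monoid `C(Δ_n X)` is `Multiset (X × Fin (n + 1))`, written additively. -/

/-- DRB monomials of order `n` on `X`: pure tensors `u₀ ⊗ u₁ ⊗ ⋯ ⊗ u_k` of commutative words
`u_i ∈ C(Δ_n X)`, `k ≥ 0`; here `head = u₀` and `tail = [u₁, …, u_k]`. -/
@[ext]
structure Mon (n : ℕ) (X : Type*) where
  head : Multiset (X × Fin (n + 1))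
  tail : List (Multiset (X × Fin (n + 1)))

/-- The unit monomial `1`. -/
def Mon.one {n : ℕ} {X : Type*} : Mon n X := ⟨0, []⟩

/-- The monomial consisting of the single letter `x^{(i)}`. -/
def Mon.letter {n : ℕ} {X : Type*} (y : X × Fin (n + 1)) : Mon n X := ⟨{y}, []⟩

/-- The breadth: the number of factors in `u = u₁ ⋯ u_k` with `u₁, …, u_{k-1} ∈ Δ_n X` and
`u_k ∈ Δ_n X ∪ P(𝔅(Δ_n X))`. -/
def Mon.bre {n : ℕ} {X : Type*} (u : Mon n X) : ℕ :=
  Multiset.card u.head + (if u.tail.isEmpty then 0 else 1)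

/-! ### The order -/

section Order

variable {n : ℕ} {X : Type*}

/-- `x^{(i)}` is compared through `(x, -i)`, lexicographically. -/
def letterKey (y : X × Fin (n + 1)) : X ×ₗ (Fin (n + 1))ᵒᵈ :=
  toLex (y.1, OrderDual.toDual y.2)

theorem letterKey_injective : Function.Injective (letterKey (n := n) (X := X)) := by
  rintro ⟨a, b⟩ ⟨c, e⟩ h
  simpa [letterKey] using h

variable [LinearOrder X]

/-- A commutative word is written with its letters in non-increasing order; such words are
compared first by length and then lexicographically. -/
noncomputable def wordKey (w : Multiset (X × Fin (n + 1))) :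
    ℕ ×ₗ List (X ×ₗ (Fin (n + 1))ᵒᵈ) :=
  toLex (Multiset.card w, (w.map letterKey).sort (· ≥ ·))

theorem wordKey_injective : Function.Injective (wordKey (n := n) (X := X)) := by
  intro a b h
  have h2 : (a.map letterKey).sort (· ≥ ·) = (b.map letterKey).sort (· ≥ ·) :=
    congrArg (fun p => (ofLex p).2) h
  have h3 := congrArg (fun l : List (X ×ₗ (Fin (n + 1))ᵒᵈ) => (l : Multiset (X ×ₗ (Fin (n + 1))ᵒᵈ))) h2
  simp only [Multiset.sort_eq] at h3
  exact Multiset.map_injective letterKey_injective h3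

/-- `u₀ ⊗ ⋯ ⊗ u_k` is compared through `(k + 1, u₀, …, u_k)`, lexicographically. -/
noncomputable def monKey (u : Mon n X) :
    ℕ ×ₗ List (ℕ ×ₗ List (X ×ₗ (Fin (n + 1))ᵒᵈ)) :=
  toLex (u.tail.length + 1, (u.head :: u.tail).map wordKey)

theorem monKey_injective : Function.Injective (monKey (n := n) (X := X)) := by
  intro a b h
  have h2 : (a.head :: a.tail).map wordKey = (b.head :: b.tail).map wordKey :=
    congrArg (fun p => (ofLex p).2) h
  have h3 := List.map_injective_iff.2 wordKey_injective h2
  rw [List.cons.injEq] at h3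
  exact Mon.ext h3.1 h3.2

/-- The order `≤_n` on DRB monomials. -/
noncomputable instance : LinearOrder (Mon n X) := LinearOrder.lift' monKey monKey_injective

end Order

/-! ### Mixable shuffle (quasi-shuffle) product of weight `lam` -/

section Shuffle

variable {k : Type*} [CommRing k] {M : Type*}

/-- Prefixing every word with the letter `a`. -/
noncomputable def consMap (k : Type*) [CommRing k] (a : M) :
    (List M →₀ k) →ₗ[k] (List M →₀ k) :=
  Finsupp.lmapDomain k k (List.cons a)

theorem consMap_single (a : M) (as : List M) (c : k) :
    consMap k a (Finsupp.single as c) = Finsupp.single (a :: as) c := by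
  simp [consMap]

variable [AddCommMonoid M]

/-- The mixable shuffle of two words. The product of letters is written additively. -/
noncomputable def shuffle (lam : k) : List M → List M → (List M →₀ k)
  | [], bs => Finsupp.single bs 1
  | a :: as, [] => Finsupp.single (a :: as) 1
  | a :: as, b :: bs =>
      consMap k a (shuffle lam as (b :: bs)) + consMap k b (shuffle lam (a :: as) bs)
        + lam • consMap k (a + b) (shuffle lam as bs)

/-- Bilinear extension of the mixable shuffle. -/
noncomputable def shuffleMul (lam : k) :
    (List M →₀ k) →ₗ[k] (List M →₀ k) →ₗ[k] (List M →₀ k) :=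
  Finsupp.linearCombination k fun as =>
    Finsupp.linearCombination k fun bs => shuffle lam as bs

theorem shuffleMul_single (lam : k) (as bs : List M) :
    shuffleMul lam (Finsupp.single as 1) (Finsupp.single bs 1) = shuffle lam as bs := by
  simp [shuffleMul]

theorem shuffle_nil_right (lam : k) (as : List M) :
    shuffle lam as [] = Finsupp.single as 1 := by
  cases as <;> simp [shuffle]

theorem shuffle_comm (lam : k) (as bs : List M) : shuffle lam as bs = shuffle lam bs as := by
  induction as generalizing bs with
  | nil => simp [shuffle, shuffle_nil_right]
  | cons a as ih =>
    induction bs with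
    | nil => simp [shuffle]
    | cons b bs ihb =>
      simp only [shuffle]
      rw [ih, ih, ihb, add_comm a b]
      abel

theorem shuffleMul_nil_left (lam : k) (f : List M →₀ k) :
    shuffleMul lam (Finsupp.single [] 1) f = f := by
  induction f using Finsupp.induction_linear with
  | zero => simp
  | add f g hf hg => simp [hf, hg]
  | single as c =>
    rw [← mul_one c, ← smul_eq_mul, ← Finsupp.smul_single, map_smul, shuffleMul_single]
    simp [shuffle]

theorem shuffleMul_comm (lam : k) (f g : List M →₀ k) :
    shuffleMul lam f g = shuffleMul lam g f := by
  induction f using Finsupp.induction_linear with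
  | zero => simp
  | add f f' hf hf' => simp [hf, hf']
  | single as c =>
    induction g using Finsupp.induction_linear with
    | zero => simp
    | add g g' hg hg' => simp [hg, hg']
    | single bs e =>
      rw [← mul_one c, ← mul_one e, ← smul_eq_mul, ← smul_eq_mul, ← Finsupp.smul_single,
        ← Finsupp.smul_single]
      simp only [map_smul, LinearMap.smul_apply, shuffleMul_single]
      rw [shuffle_comm, smul_comm]

theorem shuffleMul_cons (lam : k) (a b : M) (f g : List M →₀ k) :
    shuffleMul lam (consMap k a f) (consMap k b g) =
      consMap k a (shuffleMul lam f (consMap k b g))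
        + consMap k b (shuffleMul lam (consMap k a f) g)
        + lam • consMap k (a + b) (shuffleMul lam f g) := by
  induction f using Finsupp.induction_linear with
  | zero => simp
  | add f f' hf hf' =>
    simp only [map_add, LinearMap.add_apply, hf, hf', smul_add]
    abel
  | single as c =>
    induction g using Finsupp.induction_linear with
    | zero => simp
    | add g g' hg hg' =>
      simp only [map_add, hg, hg', smul_add]
      abel
    | single bs e =>
      rw [← mul_one c, ← mul_one e, ← smul_eq_mul, ← smul_eq_mul, ← Finsupp.smul_single,
        ← Finsupp.smul_single]
      simp only [map_smul, LinearMap.smul_apply, consMap_single, shuffleMul_single, shuffle,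
        smul_add]
      rw [smul_comm c lam, smul_comm e lam]

theorem shuffleMul_assoc_single (lam : k) (as bs cs : List M) :
    shuffleMul lam (shuffleMul lam (Finsupp.single as 1) (Finsupp.single bs 1))
        (Finsupp.single cs 1) =
      shuffleMul lam (Finsupp.single as 1)
        (shuffleMul lam (Finsupp.single bs 1) (Finsupp.single cs 1)) := by
  induction as generalizing bs cs with
  | nil => rw [shuffleMul_nil_left, shuffleMul_nil_left]
  | cons a as iha =>
    induction bs generalizing cs with
    | nil =>
      rw [shuffleMul_nil_left, shuffleMul_comm lam _ (Finsupp.single [] 1), shuffleMul_nil_left]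
    | cons b bs ihb =>
      induction cs with
      | nil =>
        rw [shuffleMul_comm lam _ (Finsupp.single [] 1), shuffleMul_nil_left,
          shuffleMul_comm lam (Finsupp.single (b :: bs) 1), shuffleMul_nil_left]
      | cons c cs ihc =>
        have h1 := iha (b :: bs) (c :: cs)
        have h2 := ihb (c :: cs)
        have h3 := iha bs (c :: cs)
        have h4 := iha (b :: bs) cs
        have h5 := ihb cs
        have h6 := iha bs cs
        simp only [← consMap_single] at *
        generalize (Finsupp.single as 1 : List M →₀ k) = x at *
        generalize (Finsupp.single bs 1 : List M →₀ k) = y at *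
        generalize (Finsupp.single cs 1 : List M →₀ k) = z at *
        simp only [shuffleMul_cons, map_add, LinearMap.add_apply, map_smul,
          LinearMap.smul_apply, smul_add] at *
        have e1 := congrArg (consMap k a) h1
        have e2 := congrArg (consMap k c) ihc
        simp only [map_add, map_smul] at e1 e2
        rw [h2, h3, h4, h5, h6, add_assoc a b c]
        rw [e1, ← e2]
        abel

end Shuffle

/-! ### The algebra `k𝔅(Δ_n X)` -/

/-- The algebra `k𝔅(Δ_n X)` of DRB polynomials of weight `lam`: the free `k`-module on the DRB
monomials of order `n`. -/
def Sha {k : Type*} [CommRing k] (_lam : k) (n : ℕ) (X : Type*) : Type _ := Mon n X →₀ k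

section Algebra

variable {k : Type*} [CommRing k] {lam : k} {n : ℕ} {X : Type*}

noncomputable instance : AddCommGroup (Sha lam n X) :=
  inferInstanceAs (AddCommGroup (Mon n X →₀ k))

noncomputable instance : Module k (Sha lam n X) :=
  inferInstanceAs (Module k (Mon n X →₀ k))

/-- The coordinates of an element of `k𝔅(Δ_n X)` in the basis of DRB monomials. -/
noncomputable def Sha.coords : Sha lam n X ≃ₗ[k] (Mon n X →₀ k) := LinearEquiv.refl k _

/-- A DRB monomial as an element of `k𝔅(Δ_n X)`. -/
noncomputable def mon (u : Mon n X) : Sha lam n X := Sha.coords.symm (Finsupp.single u 1)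

/-- Linear extension of a map from DRB monomials to a module. -/
noncomputable def extend {N : Type*} [AddCommGroup N] [Module k N] (φ : Mon n X → N) :
    Sha lam n X →ₗ[k] N :=
  (Finsupp.linearCombination k φ).comp Sha.coords.toLinearMap

theorem extend_mon {N : Type*} [AddCommGroup N] [Module k N] (φ : Mon n X → N) (u : Mon n X) :
    extend (lam := lam) φ (mon u) = φ u := by
  simp [extend, mon]

theorem Sha.induction {p : Sha lam n X → Prop} (f : Sha lam n X) (zero : p 0)
    (add : ∀ f g, p f → p g → p (f + g)) (smul : ∀ (c : k) u, p (c • mon u)) : p f := by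
  refine Finsupp.induction_linear (motive := p) f zero add fun u c => ?_
  have h : (Finsupp.single u c : Mon n X →₀ k) = c • Finsupp.single u 1 := by simp
  exact h ▸ smul c u

/-- `a ⊗ f`, for a word `a` and a combination `f` of lists of words. -/
noncomputable def tensorHead (a : Multiset (X × Fin (n + 1))) :
    (List (Multiset (X × Fin (n + 1))) →₀ k) →ₗ[k] Sha lam n X :=
  Finsupp.linearCombination k fun t => mon ⟨a, t⟩

/-- The product `(a₀ ⊗ a) ⋄ (b₀ ⊗ b) = a₀ b₀ ⊗ (a * b)`, with `*` the mixable shuffle, extended bilinearly. -/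
noncomputable def mulMap :
    Sha lam n X →ₗ[k] Sha lam n X →ₗ[k] Sha lam n X :=
  extend fun u => extend fun v => tensorHead (u.head + v.head) (shuffle lam u.tail v.tail)

noncomputable instance : Mul (Sha lam n X) := ⟨fun f g => mulMap f g⟩

noncomputable instance : One (Sha lam n X) := ⟨mon Mon.one⟩

theorem mul_def (f g : Sha lam n X) : f * g = mulMap f g := rfl

theorem one_def : (1 : Sha lam n X) = mon Mon.one := rfl

theorem mon_mul_mon (u v : Mon n X) : (mon u * mon v : Sha lam n X) =
    tensorHead (u.head + v.head) (shuffle lam u.tail v.tail) := by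
  rw [mul_def, mulMap, extend_mon, extend_mon]

theorem tensorHead_single (a : Multiset (X × Fin (n + 1)))
    (t : List (Multiset (X × Fin (n + 1)))) :
    tensorHead a (Finsupp.single t (1 : k)) = (mon ⟨a, t⟩ : Sha lam n X) := by
  simp [tensorHead]

theorem tensorHead_mul (a b : Multiset (X × Fin (n + 1)))
    (f g : List (Multiset (X × Fin (n + 1))) →₀ k) :
    (tensorHead a f * tensorHead b g : Sha lam n X) =
      tensorHead (a + b) (shuffleMul lam f g) := by
  rw [mul_def]
  induction f using Finsupp.induction_linear with
  | zero => simp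
  | add f f' hf hf' => simp only [map_add, LinearMap.add_apply, hf, hf']
  | single as c =>
    induction g using Finsupp.induction_linear with
    | zero => simp
    | add g g' hg hg' => simp only [map_add, hg, hg']
    | single bs e =>
      rw [← mul_one c, ← mul_one e, ← smul_eq_mul, ← smul_eq_mul, ← Finsupp.smul_single,
        ← Finsupp.smul_single]
      simp only [map_smul, LinearMap.smul_apply, tensorHead_single, ← mul_def, mon_mul_mon,
        shuffleMul_single]

theorem mon_eq_tensorHead (u : Mon n X) :
    (mon u : Sha lam n X) = tensorHead u.head (Finsupp.single u.tail 1) := by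
  rw [tensorHead_single]

theorem sha_mul_comm (f g : Sha lam n X) : f * g = g * f := by
  rw [mul_def, mul_def]
  induction f using Sha.induction with
  | zero => simp
  | add f f' hf hf' => simp only [map_add, LinearMap.add_apply, hf, hf']
  | smul c u =>
    induction g using Sha.induction with
    | zero => simp
    | add g g' hg hg' => simp only [map_add, LinearMap.add_apply, hg, hg']
    | smul e v =>
      simp only [map_smul, LinearMap.smul_apply, ← mul_def, mon_mul_mon]
      rw [add_comm u.head, shuffle_comm, smul_comm]

theorem sha_one_mul (f : Sha lam n X) : 1 * f = f := by
  rw [mul_def]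
  induction f using Sha.induction with
  | zero => simp
  | add f f' hf hf' => simp only [map_add, hf, hf']
  | smul c u =>
    rw [map_smul, ← mul_def, one_def, mon_mul_mon]
    simp [Mon.one, shuffle, tensorHead_single]

theorem sha_mul_assoc (f g h : Sha lam n X) : f * g * h = f * (g * h) := by
  simp only [mul_def]
  induction f using Sha.induction with
  | zero => simp
  | add f f' hf hf' => simp only [map_add, LinearMap.add_apply, hf, hf']
  | smul c u =>
    induction g using Sha.induction with
    | zero => simp
    | add g g' hg hg' => simp only [map_add, LinearMap.add_apply, hg, hg']
    | smul e v =>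
      induction h using Sha.induction with
      | zero => simp
      | add h h' hh hh' => simp only [map_add, hh, hh']
      | smul r w =>
        simp only [map_smul, LinearMap.smul_apply, ← mul_def, mon_eq_tensorHead,
          tensorHead_mul, shuffleMul_assoc_single, add_assoc]

noncomputable instance : CommRing (Sha lam n X) :=
  { (inferInstance : AddCommGroup (Sha lam n X)) with
    mul := (· * ·)
    one := 1
    mul_assoc := sha_mul_assoc
    mul_comm := sha_mul_comm
    one_mul := sha_one_mul
    mul_one := fun f => by rw [sha_mul_comm, sha_one_mul]
    left_distrib := fun f g h => map_add (mulMap f) g h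
    right_distrib := fun f g h => by simp only [mul_def, map_add, LinearMap.add_apply]
    zero_mul := fun f => by simp only [mul_def, map_zero, LinearMap.zero_apply]
    mul_zero := fun f => map_zero (mulMap f) }

noncomputable instance : Algebra k (Sha lam n X) :=
  Algebra.ofModule
    (fun c f g => by simp only [mul_def, map_smul, LinearMap.smul_apply])
    (fun c f g => by simp only [mul_def, map_smul])

/-! ### The operators `P` and `d` -/

/-- `P(u₀ ⊗ ⋯ ⊗ u_k) = 1 ⊗ u₀ ⊗ ⋯ ⊗ u_k`. -/
noncomputable def opP : Sha lam n X →ₗ[k] Sha lam n X :=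
  extend fun u => mon ⟨0, u.head :: u.tail⟩

/-- `d(x^{(i)}) = x^{(i+1)}` for `i < n`, and `d(x^{(n)}) = 0`. -/
noncomputable def dLetter (y : X × Fin (n + 1)) : Sha lam n X :=
  if h : (y.2 : ℕ) + 1 < n + 1 then mon (Mon.letter (y.1, ⟨(y.2 : ℕ) + 1, h⟩)) else 0

/-- From the pair `(w, d w)` to the pair `(y w, d(y w))`, where
`d(y w) = d(y) w + y d(w) + lam d(y) d(w)`. -/
noncomputable def dStep (y : X × Fin (n + 1)) (p : Sha lam n X × Sha lam n X) :
    Sha lam n X × Sha lam n X :=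
  (mon (Mon.letter y) * p.1,
    dLetter y * p.1 + mon (Mon.letter y) * p.2 + lam • (dLetter y * p.2))

instance : LeftCommutative (dStep (lam := lam) (n := n) (X := X)) :=
  ⟨fun y z p => by
    ext1
    · simp only [dStep]; ring
    · simp only [dStep, Algebra.smul_def]; ring⟩

/-- The derivation on commutative words, with `d(1) = 0`. -/
noncomputable def dWord (w : Multiset (X × Fin (n + 1))) : Sha lam n X :=
  (w.foldr dStep ((1, 0) : Sha lam n X × Sha lam n X)).2

/-- The derivation on DRB monomials: `d(u₀) ` is the derivation of a word, and
`d(u₀ ⊗ u₁ ⊗ ⋯) = d(u₀) ⊗ u₁ ⊗ ⋯ + u₀u₁ ⊗ u₂ ⊗ ⋯ + lam d(u₀)u₁ ⊗ u₂ ⊗ ⋯`. -/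
noncomputable def dMon : Mon n X → Sha lam n X
  | ⟨u₀, []⟩ => dWord u₀
  | ⟨u₀, u₁ :: us⟩ =>
      dWord u₀ * mon ⟨0, u₁ :: us⟩ + mon ⟨u₀ + u₁, us⟩ + lam • (dWord u₀ * mon ⟨u₁, us⟩)

/-- The derivation `d` on `k𝔅(Δ_n X)`. -/
noncomputable def opD : Sha lam n X →ₗ[k] Sha lam n X := extend dMon

end Algebra

/-! ### Bracketed monomials -/

/-- Formal expressions in a commutative monoid with two operators `d` and `P`. -/
inductive OpExpr (X : Type*) : Type _
  | var : X → OpExpr X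
  | one : OpExpr X
  | mul : OpExpr X → OpExpr X → OpExpr X
  | d : OpExpr X → OpExpr X
  | P : OpExpr X → OpExpr X

/-- The congruence generated by the axioms of commutative monoids. -/
inductive OpExpr.Rel {X : Type*} : OpExpr X → OpExpr X → Prop
  | refl (a : OpExpr X) : Rel a a
  | symm {a b : OpExpr X} : Rel a b → Rel b a
  | trans {a b c : OpExpr X} : Rel a b → Rel b c → Rel a c
  | mul_congr {a a' b b' : OpExpr X} : Rel a a' → Rel b b' → Rel (a.mul b) (a'.mul b')
  | d_congr {a b : OpExpr X} : Rel a b → Rel a.d b.d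
  | P_congr {a b : OpExpr X} : Rel a b → Rel a.P b.P
  | mul_assoc (a b c : OpExpr X) : Rel ((a.mul b).mul c) (a.mul (b.mul c))
  | mul_comm (a b : OpExpr X) : Rel (a.mul b) (b.mul a)
  | one_mul (a : OpExpr X) : Rel (OpExpr.one.mul a) a

instance OpExpr.setoid (X : Type*) : Setoid (OpExpr X) :=
  ⟨OpExpr.Rel, OpExpr.Rel.refl, OpExpr.Rel.symm, OpExpr.Rel.trans⟩

/-- The free commutative operated monoid `ℭ(X)` on `X` with operators `d` and `P`; its elements
are the bracketed monomials. The letter `x^{(i)}` is the bracketed monomial `d^i(x)`. -/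
def Bracketed (X : Type*) : Type _ := Quotient (OpExpr.setoid X)

namespace Bracketed

variable {X : Type*}

def var (x : X) : Bracketed X := Quotient.mk _ (OpExpr.var x)

def d : Bracketed X → Bracketed X := Quotient.map OpExpr.d fun _ _ h => OpExpr.Rel.d_congr h

def P : Bracketed X → Bracketed X := Quotient.map OpExpr.P fun _ _ h => OpExpr.Rel.P_congr h

instance : CommMonoid (Bracketed X) where
  mul := Quotient.map₂ OpExpr.mul fun _ _ h _ _ h' => OpExpr.Rel.mul_congr h h'
  one := Quotient.mk _ OpExpr.one
  mul_assoc := by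
    rintro ⟨a⟩ ⟨b⟩ ⟨c⟩
    exact Quotient.sound (OpExpr.Rel.mul_assoc a b c)
  mul_comm := by
    rintro ⟨a⟩ ⟨b⟩
    exact Quotient.sound (OpExpr.Rel.mul_comm a b)
  one_mul := by
    rintro ⟨a⟩
    exact Quotient.sound (OpExpr.Rel.one_mul a)
  mul_one := by
    rintro ⟨a⟩
    exact Quotient.sound ((OpExpr.Rel.mul_comm a _).trans (OpExpr.Rel.one_mul a))

end Bracketed

section Eval

variable {X G : Type*} [CommMonoid G]

/-- Value of an expression in a commutative monoid with operators `dG` and `PG`. -/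
def OpExpr.eval (dG PG : G → G) (f : X → G) : OpExpr X → G
  | .var x => f x
  | .one => 1
  | .mul a b => a.eval dG PG f * b.eval dG PG f
  | .d a => dG (a.eval dG PG f)
  | .P a => PG (a.eval dG PG f)

theorem OpExpr.eval_eq (dG PG : G → G) (f : X → G) {a b : OpExpr X} (h : OpExpr.Rel a b) :
    a.eval dG PG f = b.eval dG PG f := by
  induction h with
  | refl a => rfl
  | symm _ ih => exact ih.symm
  | trans _ _ ih ih' => exact ih.trans ih'
  | mul_congr _ _ ih ih' => simp only [OpExpr.eval, ih, ih']
  | d_congr _ ih => simp only [OpExpr.eval, ih]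
  | P_congr _ ih => simp only [OpExpr.eval, ih]
  | mul_assoc a b c => simp only [OpExpr.eval, _root_.mul_assoc]
  | mul_comm a b => simp only [OpExpr.eval, _root_.mul_comm]
  | one_mul a => simp only [OpExpr.eval, _root_.one_mul]

/-- The homomorphism of operated monoids from `ℭ(X)` extending `f : X → G`. -/
def Bracketed.lift (dG PG : G → G) (f : X → G) : Bracketed X →* G where
  toFun := Quotient.lift (OpExpr.eval dG PG f) fun _ _ h => OpExpr.eval_eq dG PG f h
  map_one' := rfl
  map_mul' := by
    rintro ⟨a⟩ ⟨b⟩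
    rfl

/-- The value of a commutative word, the letter `x^{(i)}` having the value `d^i(f x)`. -/
def evalWord {n : ℕ} (dG : G → G) (f : X → G) (w : Multiset (X × Fin (n + 1))) : G :=
  (w.map fun y => dG^[(y.2 : ℕ)] (f y.1)).prod

/-- `P(u₁ P(u₂ P(⋯ P(u_k) ⋯)))`, and `1` if `k = 0`. -/
def evalTail {n : ℕ} (dG PG : G → G) (f : X → G) : List (Multiset (X × Fin (n + 1))) → G
  | [] => 1
  | u :: us => PG (evalWord dG f u * evalTail dG PG f us)

/-- The value `u₀ P(u₁ P(⋯ P(u_k) ⋯))` of the DRB monomial `u₀ ⊗ u₁ ⊗ ⋯ ⊗ u_k`. -/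
def Mon.eval {n : ℕ} (dG PG : G → G) (f : X → G) (u : Mon n X) : G :=
  evalWord dG f u.head * evalTail dG PG f u.tail

end Eval

section Substitution

variable {k : Type*} [CommRing k] {lam : k} {n : ℕ} {X : Type*}

/-- The DRB monomial `u₀ ⊗ ⋯ ⊗ u_k` as the bracketed monomial `u₀ P(u₁ P(⋯ P(u_k) ⋯))`. -/
def toBracketed (u : Mon n X) : Bracketed X := u.eval Bracketed.d Bracketed.P Bracketed.var

/-- The `⋆`-DRB monomials on `Δ_n X`: DRB monomials on `Δ_n (X ∪ {⋆})` in which exactly one letter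
is of the form `⋆^{(ℓ)}`. The symbol `⋆` is `none : Option X`. -/
def StarMon (n : ℕ) (X : Type*) : Type _ :=
  { q : Mon n (Option X) //
    ((q.head :: q.tail).map (Multiset.countP fun y => y.1.isNone)).sum = 1 }

/-- `q|_u`, a bracketed monomial. -/
def StarMon.subst (q : StarMon n X) (u : Mon n X) : Bracketed X :=
  q.1.eval Bracketed.d Bracketed.P fun o => o.elim (toBracketed u) Bracketed.var

/-- `q|_s = ∑ c_i q|_{u_i}` for `s = ∑ c_i u_i`, an element of `kℭ(X)`. -/
noncomputable def StarMon.substPoly (q : StarMon n X) :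
    Sha lam n X →ₗ[k] MonoidAlgebra k (Bracketed X) :=
  extend fun u => MonoidAlgebra.of k (Bracketed X) (q.subst u)

/-- The reduction map `kℭ(X) → k𝔅(Δ_n X)`: the homomorphism of operated algebras with
`x ↦ x^{(0)}`. -/
noncomputable def red : MonoidAlgebra k (Bracketed X) →ₐ[k] Sha lam n X :=
  MonoidAlgebra.lift k (Sha lam n X) (Bracketed X)
    (Bracketed.lift (opD (lam := lam)) (opP (lam := lam)) fun x => mon (Mon.letter (x, 0)))

end Substitution

/-! ### Leading terms, normality, compositions -/

section GroebnerShirshov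

variable {k : Type*} [CommRing k] {lam : k} {n : ℕ} {X : Type*} [LinearOrder X]

open Classical in
/-- The leading monomial `f̄` of `f ≠ 0`; the value at `f = 0` plays no role. -/
noncomputable def lead (f : Sha lam n X) : Mon n X :=
  if h : (Sha.coords f).support.Nonempty then (Sha.coords f).support.max' h else Mon.one

/-- `f` is nonzero and its leading coefficient is `1`. -/
def Monic (f : Sha lam n X) : Prop := f ≠ 0 ∧ Sha.coords f (lead f) = 1

/-- `q|_s` is normal: the bracketed monomial `q|_{s̄}` is a DRB monomial of order `n`. -/
def Normal (q : StarMon n X) (s : Sha lam n X) : Prop :=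
  ∃ w : Mon n X, toBracketed w = q.subst (lead s)

/-- `h` is trivial mod `[S]`: `h = ∑ c_i q_i|_{s_i}` with `s_i ∈ S`, `q_i|_{s_i}` normal and
`q_i|_{s̄_i} ≤ h̄`. The sum may be empty. -/
def Trivial (S : Set (Sha lam n X)) (h : Sha lam n X) : Prop :=
  h ∈ Submodule.span k { g | ∃ (q : StarMon n X) (s : Sha lam n X), s ∈ S ∧ Normal q s ∧
    (∃ w : Mon n X, toBracketed w = q.subst (lead s) ∧ w ≤ lead h) ∧
    g = red (q.substPoly s) }

/-- `h ≡ 0` mod `(S, w)`: `h = ∑ c_i q_i|_{s_i}` with `s_i ∈ S`, `q_i|_{s_i}` normal and the leading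
monomial of `q_i|_{s_i}` smaller than `w`. -/
def TrivialBelow (S : Set (Sha lam n X)) (w : Mon n X) (h : Sha lam n X) : Prop :=
  h ∈ Submodule.span k { g | ∃ (q : StarMon n X) (s : Sha lam n X), s ∈ S ∧ Normal q s ∧
    lead (red (q.substPoly s) : Sha lam n X) < w ∧ g = red (q.substPoly s) }

/-- The monomials in `C(Δ_n X) P(𝔅(Δ_n X))`, that is, those of depth at least two. -/
def Mon.HasP {n : ℕ} {X : Type*} (u : Mon n X) : Prop := u.tail ≠ []

/-- `(u, v)` is an intersection pair for `(f, g)` with `w = f u = v g`: the products are DRB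
monomials, `v` is a commutative word, and `bre(w) < bre(f) + bre(g)`. -/
def IntersectionPair {n : ℕ} {X : Type*} (f g u v w : Mon n X) : Prop :=
  ¬ v.HasP ∧ toBracketed w = toBracketed f * toBracketed u ∧
    toBracketed w = toBracketed v * toBracketed g ∧ w.bre < f.bre + g.bre

/-- Gröbner-Shirshov bases: all compositions of multiplication and of derivation are trivial
mod `[S]`, and all intersection and including compositions are trivial modulo `(S, w)`.

The composition of derivation `d^ℓ(f)` is formed unless `f̄ ∈ Δ_{n-ℓ} X`, in which case
`d^ℓ(⋆)|_f` is normal. -/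
structure IsGroebnerShirshov (S : Set (Sha lam n X)) : Prop where
  multiplication : ∀ f ∈ S, (lead f).HasP → ∀ u : Mon n X, u.HasP → Trivial S (f * mon u)
  derivation : ∀ f ∈ S, ∀ ℓ : ℕ, 1 ≤ ℓ →
    (¬ ∃ y : X × Fin (n + 1), (y.2 : ℕ) + ℓ ≤ n ∧ lead f = Mon.letter y) →
    Trivial S (opD^[ℓ] f)
  intersection : ∀ f ∈ S, ∀ g ∈ S, ∀ u v w : Mon n X,
    IntersectionPair (lead f) (lead g) u v w → TrivialBelow S w (f * mon u - mon v * g)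
  inclusion : ∀ f ∈ S, ∀ g ∈ S, ∀ q : StarMon n X,
    toBracketed (lead f) = q.subst (lead g) → TrivialBelow S (lead f) (f - red (q.substPoly g))

/-- `Irr(S)`: the DRB monomials not of the form `q|_{s̄}` with `s ∈ S` and `q|_s` normal. -/
def Irr (S : Set (Sha lam n X)) : Set (Mon n X) :=
  { w | ¬ ∃ (q : StarMon n X) (s : Sha lam n X), s ∈ S ∧ Normal q s ∧
    toBracketed w = q.subst (lead s) }

end GroebnerShirshov

/-- `Id(S)`: the smallest ideal of `k𝔅(Δ_n X)` that contains `S` and is closed under `d` and `P`. -/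
noncomputable def drbIdeal {k : Type*} [CommRing k] {lam : k} {n : ℕ} {X : Type*}
    (S : Set (Sha lam n X)) : Ideal (Sha lam n X) :=
  sInf { I | S ⊆ I ∧ ∀ f ∈ I, opD f ∈ I ∧ opP f ∈ I }

end DRB

/-! A normal `q|_s` is described without bracketed monomials by `NormalForm S w g`. It starts from
some `s ∈ S`, or from `d^ℓ(s)` when the leading monomial of `s` is a letter that `d^ℓ` does not
kill. It then allows multiplication by a monomial where no shuffle occurs, and the operation `g ↦ c
P(g)` for a word `c`. These operations are strictly monotone on monomials, so `q|_s` is monic with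
leading monomial `q|_{s̄}` (`NormalForm.sub_mem_lower`). The delicate operation is `d^ℓ`. Below a
letter there are only `1` and smaller letters, and on these `d^ℓ` keeps the order or gives `0`
(`iterate_opD_mem_lower`).

(a) ⇒ (b) rests on two facts. First, `Id(S)` is the linear span of the normal `q|_s`
(`IsGroebnerShirshov.drbIdeal_eq`). Multiplication and derivation compositions deal with the
products and derivatives of elements of `S` that are not normal, and the Rota-Baxter and Leibniz
identities carry this through contexts. Second, two normal elements with the same leading monomial
`w` differ by normal elements led by smaller monomials (`IsGroebnerShirshov.normalForm_sub_mem`).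
Disjoint occurrences cancel as in Buchberger's coprime criterion, nested ones are inclusion
compositions, and overlapping ones are intersection compositions times a context. Occurrences inside
derivatives also require that such congruences survive `d^ℓ`
(`IsGroebnerShirshov.iterate_opD_mem_spanBelow`), which again uses derivation compositions. A
well-founded induction on the largest monomial in a representation of `f` then finds `f̄` among the
leading monomials (`IsGroebnerShirshov.exists_normalForm_lead`).

(b) ⇒ (c): division by monic elements writes every `f` as normal elements bounded by `f̄` plus
irreducible monomials, whatever `S` is. By (b) no nonzero irreducible combination lies in `Id(S)`.

(c) ⇒ (a): if `f ∈ Id(S)`, its irreducible remainder lies in `Id(S)` and so vanishes, which leaves a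
representation bounded by `f̄`. All compositions lie in `Id(S)`, and in intersections and inclusions
the leading terms at `w` cancel. -/

namespace DRB

/-! ### Monotonicity and well-foundedness of the monomial order -/

section OrderLemmas

variable {α : Type*} [LinearOrder α]

/-- At the first difference, a letter that goes before the smaller entry either goes before the
larger one too or is itself less than the larger one. Equal lengths exclude the prefix case. -/
theorem orderedInsert_lt_orderedInsert (x : α) {l₁ l₂ : List α}
    (hlen : l₁.length = l₂.length) (h : l₁ < l₂) :
    l₁.orderedInsert (· ≥ ·) x < l₂.orderedInsert (· ≥ ·) x := by
  induction l₁ generalizing l₂ with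
  | nil =>
    cases l₂ with
    | nil => exact absurd h (lt_irrefl _)
    | cons b l₂ => simp at hlen
  | cons a l₁ ih =>
    cases l₂ with
    | nil => simp at hlen
    | cons b l₂ =>
      have hlen' : l₁.length = l₂.length := by simpa using hlen
      simp only [List.orderedInsert_cons]
      rcases List.cons_lt_cons_iff.1 h with hab | ⟨rfl, hl⟩
      · split_ifs with h1 h2 h2
        · exact List.cons_lt_cons_iff.2 (Or.inr ⟨rfl, h⟩)
        · exact List.cons_lt_cons_iff.2 (Or.inl (not_le.1 h2))
        · exact absurd (le_trans hab.le h2) h1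
        · exact List.cons_lt_cons_iff.2 (Or.inl hab)
      · split_ifs with h1
        · exact List.cons_lt_cons_iff.2 (Or.inr ⟨rfl, h⟩)
        · exact List.cons_lt_cons_iff.2 (Or.inr ⟨rfl, ih hlen' hl⟩)

theorem sort_cons_eq_orderedInsert (x : α) (s : Multiset α) :
    (x ::ₘ s).sort (· ≥ ·) = (s.sort (· ≥ ·)).orderedInsert (· ≥ ·) x := by
  refine List.Perm.eq_of_pairwise' (r := (· ≥ ·)) (Multiset.pairwise_sort _ _)
    ((Multiset.pairwise_sort s (· ≥ ·)).orderedInsert _ _) ?_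
  rw [← Multiset.coe_eq_coe, Multiset.sort_eq,
    Multiset.coe_eq_coe.2 (List.perm_orderedInsert _ _ _), ← Multiset.cons_coe, Multiset.sort_eq]

theorem list_append_lt_append_right {l₁ l₂ : List α} (hlen : l₁.length = l₂.length) (h : l₁ < l₂)
    (r : List α) : l₁ ++ r < l₂ ++ r := by
  induction l₁ generalizing l₂ with
  | nil =>
    cases l₂ with
    | nil => exact absurd h (lt_irrefl _)
    | cons b l₂ => simp at hlen
  | cons a l₁ ih =>
    cases l₂ with
    | nil => simp at hlen
    | cons b l₂ =>
      simp only [List.cons_append]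
      rcases List.cons_lt_cons_iff.1 h with hab | ⟨rfl, hl⟩
      · exact List.cons_lt_cons_iff.2 (Or.inl hab)
      · exact List.cons_lt_cons_iff.2 (Or.inr ⟨rfl, ih (by simpa using hlen) hl⟩)

variable {n : ℕ} {X : Type*} [LinearOrder X]

theorem wordKey_lt_iff (a b : Multiset (X × Fin (n + 1))) : wordKey a < wordKey b ↔
    Multiset.card a < Multiset.card b ∨ Multiset.card a = Multiset.card b ∧
      (a.map letterKey).sort (· ≥ ·) < (b.map letterKey).sort (· ≥ ·) :=
  Prod.Lex.toLex_lt_toLex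

theorem wordKey_add_lt (c : Multiset (X × Fin (n + 1))) {a b : Multiset (X × Fin (n + 1))}
    (h : wordKey a < wordKey b) : wordKey (c + a) < wordKey (c + b) := by
  induction c using Multiset.induction with
  | empty => simpa using h
  | cons y c ih =>
    rw [Multiset.cons_add, Multiset.cons_add]
    rw [wordKey_lt_iff] at ih ⊢
    rcases ih with ih | ⟨h1, h2⟩
    · exact Or.inl (by simpa using ih)
    · refine Or.inr ⟨by simp only [Multiset.card_cons, h1], ?_⟩
      rw [Multiset.map_cons, Multiset.map_cons, sort_cons_eq_orderedInsert,
        sort_cons_eq_orderedInsert]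
      exact orderedInsert_lt_orderedInsert _
        (by simp only [Multiset.length_sort, Multiset.card_map, h1]) h2

theorem Mon.lt_iff (u v : Mon n X) : u < v ↔ u.tail.length < v.tail.length ∨
    u.tail.length = v.tail.length ∧ (wordKey u.head < wordKey v.head ∨
      u.head = v.head ∧ u.tail.map wordKey < v.tail.map wordKey) := by
  have h : u < v ↔ monKey u < monKey v := Iff.rfl
  rw [h, monKey, monKey, Prod.Lex.toLex_lt_toLex]
  simp only [add_lt_add_iff_right, add_left_inj, List.map_cons, List.cons_lt_cons_iff,
    wordKey_injective.eq_iff]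

theorem Mon.length_le_of_lt {u v : Mon n X} (h : u < v) : u.tail.length ≤ v.tail.length := by
  rcases (Mon.lt_iff u v).1 h with h | h
  · exact h.le
  · exact h.1.le

theorem Mon.tail_eq_nil_of_lt {u v : Mon n X} (h : u < v) (hv : v.tail = []) : u.tail = [] := by
  have := Mon.length_le_of_lt h
  simpa [hv] using this

/-- This is monotonicity of multiplication by `c ⊗ r` wherever no shuffle occurs; the comparison
itself needs no such restriction. -/
theorem Mon.add_append_lt {u v : Mon n X} (h : u < v) (c : Multiset (X × Fin (n + 1)))
    (r : List (Multiset (X × Fin (n + 1)))) :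
    (⟨c + u.head, u.tail ++ r⟩ : Mon n X) < ⟨c + v.head, v.tail ++ r⟩ := by
  rw [Mon.lt_iff] at h ⊢
  simp only [List.length_append, add_lt_add_iff_right, add_left_inj, List.map_append,
    add_right_inj]
  rcases h with h | ⟨h1, h | ⟨h2, h3⟩⟩
  · exact Or.inl h
  · exact Or.inr ⟨h1, Or.inl (wordKey_add_lt c h)⟩
  · exact Or.inr ⟨h1, Or.inr ⟨h2, list_append_lt_append_right (by simp [h1]) h3 _⟩⟩

theorem Mon.cons_lt_cons {u v : Mon n X} (h : u < v) (c : Multiset (X × Fin (n + 1))) :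
    (⟨c, u.head :: u.tail⟩ : Mon n X) < ⟨c, v.head :: v.tail⟩ := by
  rw [Mon.lt_iff] at h ⊢
  simp only [List.length_cons, add_lt_add_iff_right, add_left_inj, List.map_cons,
    List.cons_lt_cons_iff, wordKey_injective.eq_iff, true_and, lt_irrefl, false_or]
  exact h

/-- Tensor length and then word length are compared first. This controls the derivatives of the
lower terms of an element led by a letter. -/
theorem Mon.lt_letter {u : Mon n X} {y : X × Fin (n + 1)} (h : u < Mon.letter y) :
    u = Mon.one ∨ ∃ z, u = Mon.letter z ∧ letterKey z < letterKey y := by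
  obtain ⟨a, t⟩ := u
  have ht : t = [] := Mon.tail_eq_nil_of_lt h rfl
  subst ht
  rw [Mon.lt_iff] at h
  simp only [Mon.letter, lt_irrefl, false_or, true_and, List.map_nil, and_false, or_false,
    wordKey_lt_iff] at h
  rcases h with h | ⟨h1, h2⟩
  · left
    have : a = 0 := by simpa using h
    simp [this, Mon.one]
  · right
    obtain ⟨z, rfl⟩ := Multiset.card_eq_one.1 (h1.trans (Multiset.card_singleton y))
    refine ⟨z, rfl, ?_⟩
    simpa [List.cons_lt_cons_iff] using h2

theorem Mon.letter_lt_letter {z y : X × Fin (n + 1)} :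
    (Mon.letter z : Mon n X) < Mon.letter y ↔ letterKey z < letterKey y := by
  rw [Mon.lt_iff]
  simp [Mon.letter, wordKey_lt_iff, List.cons_lt_cons_iff]

theorem letterKey_lt_iff {z y : X × Fin (n + 1)} :
    letterKey z < letterKey y ↔ z.1 < y.1 ∨ z.1 = y.1 ∧ y.2 < z.2 := by
  simp [letterKey, Prod.Lex.toLex_lt_toLex]

/-- The lexicographic order on lists alone is not well founded in general. Comparing lengths first
gives shortlex orders at both levels: words over letters, tensors over words. -/
instance [WellFoundedLT X] : WellFoundedLT (Mon n X) := by
  have h0 : WellFounded ((· < ·) : X ×ₗ (Fin (n + 1))ᵒᵈ → X ×ₗ (Fin (n + 1))ᵒᵈ → Prop) :=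
    wellFounded_lt
  have h1 : WellFounded (fun a b : Multiset (X × Fin (n + 1)) => wordKey a < wordKey b) := by
    refine Subrelation.wf ?_ (InvImage.wf
      (fun a : Multiset (X × Fin (n + 1)) => (a.map letterKey).sort (· ≥ ·)) (List.Shortlex.wf h0))
    intro a b h
    rw [InvImage, List.shortlex_def]
    simpa [wordKey_lt_iff] using h
  refine ⟨Subrelation.wf ?_ (InvImage.wf
      (fun u : Mon n X => u.head :: u.tail) (List.Shortlex.wf h1))⟩
  intro u v h
  rw [InvImage, List.shortlex_def]
  rw [Mon.lt_iff] at h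
  have key : ∀ l₁ l₂ : List (Multiset (X × Fin (n + 1))), l₁.map wordKey < l₂.map wordKey →
      List.Lex (fun a b => wordKey a < wordKey b) l₁ l₂ := by
    intro l₁
    induction l₁ with
    | nil =>
      intro l₂ h
      cases l₂ with
      | nil => exact absurd h (lt_irrefl _)
      | cons b l₂ => exact List.Lex.nil
    | cons a l₁ ih =>
      intro l₂ h
      cases l₂ with
      | nil => simp at h
      | cons b l₂ =>
        rcases List.cons_lt_cons_iff.1 h with h | ⟨h1, h2⟩
        · exact List.Lex.rel h
        · rw [wordKey_injective h1]
          exact List.Lex.cons (ih _ h2)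
  simp only [List.length_cons, add_lt_add_iff_right, add_left_inj]
  rcases h with h | ⟨h1, h | ⟨h2, h3⟩⟩
  · exact Or.inl h
  · exact Or.inr ⟨h1, List.Lex.rel h⟩
  · rw [h2]
    exact Or.inr ⟨h1, List.Lex.cons (key _ _ h3)⟩

end OrderLemmas

/-! ### Rota-Baxter and Leibniz identities of weight `lam` -/

section ShaLemmas

variable {k : Type*} [CommRing k] {lam : k} {n : ℕ} {X : Type*}

@[elab_as_elim]
theorem Sha.induction_mon {p : Sha lam n X → Prop} (f : Sha lam n X) (zero : p 0)
    (add : ∀ f g, p f → p g → p (f + g)) (smul : ∀ (c : k) f, p f → p (c • f))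
    (mon : ∀ u, p (mon u)) : p f :=
  Sha.induction f zero add fun c u => smul c _ (mon u)

/-- A shuffle with the empty tensor has a single term. Since one of the two lists is empty, `v.tail
++ r` covers both cases. -/
theorem mon_mul_mon_of_tail (c : Multiset (X × Fin (n + 1)))
    (r : List (Multiset (X × Fin (n + 1)))) (v : Mon n X) (h : v.tail = [] ∨ r = []) :
    (mon ⟨c, r⟩ * mon v : Sha lam n X) = mon ⟨c + v.head, v.tail ++ r⟩ := by
  rw [mon_mul_mon]
  rcases h with h | h
  · simp [h, shuffle_nil_right, tensorHead_single]
  · simp [h, shuffle, tensorHead_single]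

theorem opP_mon (u : Mon n X) : opP (mon u : Sha lam n X) = mon ⟨0, u.head :: u.tail⟩ :=
  extend_mon _ _

theorem opD_mon (u : Mon n X) : opD (mon u : Sha lam n X) = dMon u :=
  extend_mon _ _

theorem mon_cons (a b : Multiset (X × Fin (n + 1))) (t : List (Multiset (X × Fin (n + 1)))) :
    (mon ⟨a, b :: t⟩ : Sha lam n X) = mon ⟨a, []⟩ * opP (mon ⟨b, t⟩) := by
  rw [opP_mon, mon_mul_mon_of_tail _ _ _ (Or.inr rfl)]
  simp

theorem opP_tensorHead (a : Multiset (X × Fin (n + 1)))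
    (f : List (Multiset (X × Fin (n + 1))) →₀ k) :
    (opP (tensorHead a f) : Sha lam n X) = tensorHead 0 (consMap k a f) := by
  induction f using Finsupp.induction_linear with
  | zero => simp
  | add f g hf hg => simp only [map_add, hf, hg]
  | single t c =>
    rw [← mul_one c, ← smul_eq_mul, ← Finsupp.smul_single]
    simp only [map_smul, tensorHead_single, opP_mon, consMap_single]

/-- The recursion of the mixable shuffle is the Rota-Baxter identity, with prefixing read as `P`. -/
theorem opP_mul_opP_mon (u v : Mon n X) : (opP (mon u) * opP (mon v) : Sha lam n X) =
    opP (mon u * opP (mon v)) + opP (opP (mon u) * mon v) + lam • opP (mon u * mon v) := by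
  simp only [opP_mon, mon_mul_mon, opP_tensorHead, shuffle, map_add, map_smul, zero_add, add_zero]

/-- The Rota-Baxter identity of weight `lam`. -/
theorem opP_mul_opP (f g : Sha lam n X) :
    opP f * opP g = opP (f * opP g) + opP (opP f * g) + lam • opP (f * g) := by
  induction f using Sha.induction_mon with
  | zero => simp
  | add f f' hf hf' =>
    simp only [map_add, add_mul, hf, hf', smul_add]
    abel
  | smul c f hf =>
    simp only [map_smul, smul_mul_assoc, hf, smul_add]
    rw [smul_comm c lam]
  | mon u =>
    induction g using Sha.induction_mon with
    | zero => simp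
    | add g g' hg hg' =>
      simp only [map_add, mul_add, hg, hg', smul_add]
      abel
    | smul c g hg =>
      simp only [map_smul, mul_smul_comm, hg, smul_add]
      rw [smul_comm c lam]
    | mon v => exact opP_mul_opP_mon u v

theorem foldr_dStep_fst (w : Multiset (X × Fin (n + 1))) :
    (w.foldr dStep ((1, 0) : Sha lam n X × Sha lam n X)).1 = mon ⟨w, []⟩ := by
  induction w using Multiset.induction with
  | empty => rfl
  | cons y w ih =>
    rw [Multiset.foldr_cons, dStep, ih, Mon.letter, mon_mul_mon_of_tail _ _ _ (Or.inr rfl)]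
    simp

theorem dWord_zero : (dWord 0 : Sha lam n X) = 0 := rfl

theorem dWord_cons (y : X × Fin (n + 1)) (w : Multiset (X × Fin (n + 1))) :
    (dWord (y ::ₘ w) : Sha lam n X) = dLetter y * mon ⟨w, []⟩ + mon (Mon.letter y) * dWord w
      + lam • (dLetter y * dWord w) := by
  rw [dWord, Multiset.foldr_cons, dStep, foldr_dStep_fst]
  rfl

theorem mon_zero_nil : (mon ⟨0, []⟩ : Sha lam n X) = 1 := rfl

theorem dWord_singleton (y : X × Fin (n + 1)) : (dWord {y} : Sha lam n X) = dLetter y := by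
  rw [← Multiset.cons_zero, dWord_cons, dWord_zero, mon_zero_nil]
  simp

theorem mon_cons_word (y : X × Fin (n + 1)) (w : Multiset (X × Fin (n + 1))) :
    (mon ⟨y ::ₘ w, []⟩ : Sha lam n X) = mon (Mon.letter y) * mon ⟨w, []⟩ := by
  rw [Mon.letter, mon_mul_mon_of_tail _ _ _ (Or.inr rfl)]
  simp

theorem mon_add_word (a b : Multiset (X × Fin (n + 1))) :
    (mon ⟨a + b, []⟩ : Sha lam n X) = mon ⟨a, []⟩ * mon ⟨b, []⟩ := by
  rw [mon_mul_mon_of_tail _ _ _ (Or.inr rfl)]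
  simp

theorem dWord_add (a b : Multiset (X × Fin (n + 1))) :
    (dWord (a + b) : Sha lam n X) = dWord a * mon ⟨b, []⟩ + mon ⟨a, []⟩ * dWord b
      + lam • (dWord a * dWord b) := by
  induction a using Multiset.induction with
  | empty => simp [dWord_zero, mon_zero_nil]
  | cons y a ih =>
    rw [Multiset.cons_add, dWord_cons, dWord_cons, ih, mon_add_word, mon_cons_word]
    simp only [Algebra.smul_def]
    ring

theorem opD_word (a : Multiset (X × Fin (n + 1))) : opD (mon ⟨a, []⟩ : Sha lam n X) = dWord a := by
  rw [opD_mon, dMon]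

/-- The defining formula of `d` on tensors, made linear in the argument of `P` so that the sums
coming from the Rota-Baxter identity can be substituted. -/
theorem opD_word_mul_opP (a : Multiset (X × Fin (n + 1))) (f : Sha lam n X) :
    opD (mon ⟨a, []⟩ * opP f) =
      dWord a * opP f + (mon ⟨a, []⟩ + lam • dWord a) * f := by
  induction f using Sha.induction_mon with
  | zero => simp
  | add f g hf hg => simp only [map_add, mul_add, hf, hg]; abel
  | smul c f hf => simp only [map_smul, mul_smul_comm, hf, smul_add]
  | mon u =>
    obtain ⟨b, t⟩ := u
    rw [← mon_cons, opD_mon, dMon, opP_mon]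
    rw [add_mul, mon_mul_mon_of_tail a [] _ (Or.inr rfl), smul_mul_assoc, add_assoc]
    simp

theorem opD_opP (f : Sha lam n X) : opD (opP f) = f := by
  have h := opD_word_mul_opP (lam := lam) 0 f
  rw [mon_zero_nil, dWord_zero] at h
  simpa using h

theorem opD_one : opD (1 : Sha lam n X) = 0 := by
  rw [← mon_zero_nil, opD_word, dWord_zero]

theorem opD_mul_mon (u v : Mon n X) : opD (mon u * mon v : Sha lam n X) =
    opD (mon u) * mon v + mon u * opD (mon v) + lam • (opD (mon u) * opD (mon v)) := by
  obtain ⟨a, t⟩ := u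
  obtain ⟨b, r⟩ := v
  cases t with
  | nil =>
    cases r with
    | nil => rw [← mon_add_word, opD_word, opD_word, opD_word, dWord_add]
    | cons r₀ r =>
      rw [mon_cons b, ← mul_assoc, ← mon_add_word, opD_word_mul_opP, opD_word_mul_opP, opD_word,
        dWord_add, mon_add_word]
      simp only [Algebra.smul_def]
      ring
  | cons t₀ t =>
    cases r with
    | nil =>
      rw [mon_cons a, mul_right_comm, ← mon_add_word, opD_word_mul_opP, opD_word_mul_opP, opD_word,
        dWord_add, mon_add_word]
      simp only [Algebra.smul_def]
      ring
    | cons r₀ r =>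
      rw [mon_cons a, mon_cons b]
      generalize (mon ⟨t₀, t⟩ : Sha lam n X) = f
      generalize (mon ⟨r₀, r⟩ : Sha lam n X) = g
      -- The Rota-Baxter identity collects the product under one `P`, to which the formula for `d`
      -- on `a P(f)` applies.
      have h : (mon ⟨a, []⟩ * opP f * (mon ⟨b, []⟩ * opP g) : Sha lam n X) =
          mon ⟨a + b, []⟩ * opP (f * opP g + opP f * g + lam • (f * g)) := by
        rw [mon_add_word, map_add, map_add, map_smul, ← opP_mul_opP]
        ring
      rw [h, opD_word_mul_opP, opD_word_mul_opP, opD_word_mul_opP, map_add, map_add, map_smul,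
        ← opP_mul_opP, dWord_add, mon_add_word]
      simp only [Algebra.smul_def]
      ring

/-- The operator `d` is a derivation of weight `lam`. -/
theorem opD_mul (f g : Sha lam n X) :
    opD (f * g) = opD f * g + f * opD g + lam • (opD f * opD g) := by
  induction f using Sha.induction_mon with
  | zero => simp
  | add f f' hf hf' =>
    simp only [map_add, add_mul, hf, hf', smul_add]
    abel
  | smul c f hf =>
    simp only [map_smul, smul_mul_assoc, hf, smul_add]
    rw [smul_comm c lam]
  | mon u =>
    induction g using Sha.induction_mon with
    | zero => simp
    | add g g' hg hg' =>
      simp only [map_add, mul_add, hg, hg', smul_add]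
      abel
    | smul c g hg =>
      simp only [map_smul, mul_smul_comm, hg, smul_add]
      rw [smul_comm c lam]
    | mon v => exact opD_mul_mon u v

theorem opD_letter_of_lt (x : X) (i : ℕ) (h : i + 1 < n + 1) :
    opD (mon (Mon.letter (x, ⟨i, by omega⟩)) : Sha lam n X) = mon (Mon.letter (x, ⟨i + 1, h⟩)) := by
  rw [Mon.letter, opD_word, dWord_singleton, dLetter, dif_pos h]

theorem opD_letter_last (x : X) (i : Fin (n + 1)) (h : ¬ (i : ℕ) + 1 < n + 1) :
    opD (mon (Mon.letter (x, i)) : Sha lam n X) = 0 := by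
  rw [Mon.letter, opD_word, dWord_singleton, dLetter, dif_neg h]

theorem iterate_opD_letter (x : X) (i ℓ : ℕ) (hi : i < n + 1) :
    opD^[ℓ] (mon (Mon.letter (x, ⟨i, hi⟩)) : Sha lam n X) =
      if h : i + ℓ < n + 1 then mon (Mon.letter (x, ⟨i + ℓ, h⟩)) else 0 := by
  induction ℓ with
  | zero => simp [hi]
  | succ ℓ ih =>
    rw [Function.iterate_succ_apply', ih]
    split_ifs with h1 h2 h2
    · exact opD_letter_of_lt x (i + ℓ) h2
    · exact opD_letter_last x _ h2
    · omega
    · exact map_zero _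

theorem iterate_opD_eq_pow (ℓ : ℕ) (f : Sha lam n X) :
    opD^[ℓ] f = ((opD : Module.End k (Sha lam n X)) ^ ℓ) f := by
  rw [Module.End.pow_apply]

theorem iterate_opD_one (ℓ : ℕ) (h : 1 ≤ ℓ) : opD^[ℓ] (1 : Sha lam n X) = 0 := by
  obtain ⟨m, rfl⟩ := Nat.exists_eq_add_of_le' h
  rw [Function.iterate_add_apply, Function.iterate_one, opD_one, iterate_opD_eq_pow, map_zero]

end ShaLemmas

/-! ### A model of the bracketed monomials that detects DRB monomials -/

section PartialMonomials

variable {n : ℕ} {X : Type*}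

/-- DRB monomials with an absorbing element adjoined, which stands for the bracketed
monomials that are not DRB monomials. -/
inductive PartialMon (n : ℕ) (X : Type*) : Type _
  | undefined : PartialMon n X
  | of (u : Mon n X) : PartialMon n X

namespace PartialMon

theorem of_injective : Function.Injective (of : Mon n X → PartialMon n X) := by
  intro u v h
  injection h

/-- The product of bracketed monomials, where it is a DRB monomial. -/
def mul : PartialMon n X → PartialMon n X → PartialMon n X
  | of ⟨a, []⟩, of ⟨b, r⟩ => of ⟨a + b, r⟩
  | of ⟨a, t :: ts⟩, of ⟨b, []⟩ => of ⟨a + b, t :: ts⟩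
  | of ⟨_, _ :: _⟩, of ⟨_, _ :: _⟩ => undefined
  | of _, undefined => undefined
  | undefined, _ => undefined

instance : Mul (PartialMon n X) := ⟨mul⟩

instance : One (PartialMon n X) := ⟨of Mon.one⟩

theorem mul_def (g h : PartialMon n X) : g * h = mul g h := rfl

theorem one_def : (1 : PartialMon n X) = of ⟨0, []⟩ := rfl

instance : CommMonoid (PartialMon n X) where
  mul_assoc := by
    rintro (_ | ⟨a, _ | ⟨t, ts⟩⟩) (_ | ⟨b, _ | ⟨r, rs⟩⟩) (_ | ⟨c, _ | ⟨s, ss⟩⟩) <;>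
      simp [mul_def, mul, add_assoc]
  mul_comm := by
    rintro (_ | ⟨a, _ | ⟨t, ts⟩⟩) (_ | ⟨b, _ | ⟨r, rs⟩⟩) <;>
      simp [mul_def, mul, add_comm]
  one_mul := by
    rintro (_ | ⟨a, t⟩) <;> simp [mul_def, mul, one_def]
  mul_one := by
    rintro (_ | ⟨a, _ | ⟨t, ts⟩⟩) <;> simp [mul_def, mul, one_def]

theorem of_mul_of (u v : Mon n X) (h : v.tail = [] ∨ u.tail = []) :
    of u * of v = of ⟨u.head + v.head, v.tail ++ u.tail⟩ := by
  obtain ⟨a, _ | ⟨t, ts⟩⟩ := u <;> obtain ⟨b, _ | ⟨r, rs⟩⟩ := v <;>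
    simp [mul_def, mul] at h ⊢

theorem mul_eq_of {g h : PartialMon n X} {w : Mon n X} (hw : g * h = of w) :
    ∃ u v : Mon n X, g = of u ∧ h = of v ∧ (v.tail = [] ∨ u.tail = []) ∧
      w = ⟨u.head + v.head, v.tail ++ u.tail⟩ := by
  rcases g with _ | ⟨a, _ | ⟨t, ts⟩⟩ <;> rcases h with _ | ⟨b, _ | ⟨r, rs⟩⟩ <;>
    simp [mul_def, mul] at hw <;> subst hw
  · exact ⟨_, _, rfl, rfl, Or.inl rfl, rfl⟩
  · exact ⟨_, _, rfl, rfl, Or.inr rfl, by simp⟩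
  · exact ⟨_, _, rfl, rfl, Or.inl rfl, rfl⟩

open Classical in
/-- The operator `d`, where its value is a DRB monomial. -/
noncomputable def d (g : PartialMon n X) : PartialMon n X :=
  if h : ∃ y : X × Fin (n + 1), (y.2 : ℕ) + 1 < n + 1 ∧ g = of (Mon.letter y) then
    of (Mon.letter (h.choose.1, ⟨(h.choose.2 : ℕ) + 1, h.choose_spec.1⟩)) else undefined

/-- The operator `P`. -/
def P : PartialMon n X → PartialMon n X
  | of u => of ⟨0, u.head :: u.tail⟩
  | undefined => undefined

theorem P_of (u : Mon n X) : P (of u) = of ⟨0, u.head :: u.tail⟩ := rfl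

theorem P_eq_of {g : PartialMon n X} {w : Mon n X} (h : P g = of w) :
    ∃ u : Mon n X, g = of u ∧ w = ⟨0, u.head :: u.tail⟩ := by
  cases g with
  | undefined => exact absurd h (by simp [P])
  | of u => exact ⟨u, rfl, (of_injective h).symm⟩

theorem letter_injective : Function.Injective (Mon.letter : X × Fin (n + 1) → Mon n X) := by
  intro y z h
  simpa [Mon.letter] using h

theorem d_letter (x : X) (i : ℕ) (h : i + 1 < n + 1) :
    d (of (Mon.letter (x, ⟨i, by omega⟩)) : PartialMon n X) = of (Mon.letter (x, ⟨i + 1, h⟩)) := by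
  have hex : ∃ y : X × Fin (n + 1), (y.2 : ℕ) + 1 < n + 1 ∧
      (of (Mon.letter (x, ⟨i, by omega⟩)) : PartialMon n X) = of (Mon.letter y) :=
    ⟨(x, ⟨i, by omega⟩), h, rfl⟩
  rw [d, dif_pos hex]
  have hy := letter_injective (of_injective hex.choose_spec.2)
  congr 2
  ext1
  · exact (congrArg Prod.fst hy).symm
  · have := congrArg (fun y => (y.2 : ℕ)) hy
    ext
    simp only at this ⊢
    omega

theorem d_eq_of {g : PartialMon n X} {w : Mon n X} (h : d g = of w) :
    ∃ (x : X) (i : ℕ) (hi : i + 1 < n + 1), g = of (Mon.letter (x, ⟨i, by omega⟩)) ∧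
      w = Mon.letter (x, ⟨i + 1, hi⟩) := by
  rw [d] at h
  split_ifs at h with hex
  · exact ⟨hex.choose.1, hex.choose.2, hex.choose_spec.1, hex.choose_spec.2, (of_injective h).symm⟩

theorem iterate_d_letter (x : X) (i ℓ : ℕ) (h : i + ℓ < n + 1) :
    d^[ℓ] (of (Mon.letter (x, ⟨i, by omega⟩)) : PartialMon n X) =
      of (Mon.letter (x, ⟨i + ℓ, h⟩)) := by
  induction ℓ with
  | zero => rfl
  | succ ℓ ih =>
    rw [Function.iterate_succ_apply', ih (by omega), d_letter x (i + ℓ) (by omega)]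
    rfl

/-- Every intermediate derivative must be defined, hence come from a letter. So a properly derived
star is filled normally only by a letter. -/
theorem iterate_d_eq_of {ℓ : ℕ} (hℓ : 1 ≤ ℓ) {g : PartialMon n X} {w : Mon n X}
    (h : d^[ℓ] g = of w) :
    ∃ (x : X) (i : ℕ) (hi : i + ℓ < n + 1), g = of (Mon.letter (x, ⟨i, by omega⟩)) ∧
      w = Mon.letter (x, ⟨i + ℓ, hi⟩) := by
  induction ℓ, hℓ using Nat.le_induction generalizing w with
  | base => exact d_eq_of h
  | succ ℓ hℓ ih =>
    rw [Function.iterate_succ_apply'] at h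
    obtain ⟨x, i, hi, h1, h2⟩ := d_eq_of h
    obtain ⟨x', j, hj, h3, h4⟩ := ih h1
    have h5 := letter_injective h4
    simp only [Prod.mk.injEq, Fin.mk.injEq] at h5
    obtain ⟨rfl, rfl⟩ := h5
    exact ⟨x, j, hi, h3, h2⟩

end PartialMon

end PartialMonomials

/-! ### Evaluation of monomials and the embedding into bracketed monomials -/

section Evaluation

variable {X G H : Type*} [CommMonoid G] [CommMonoid H] {n : ℕ}

theorem Bracketed.lift_d (dG PG : G → G) (f : X → G) (z : Bracketed X) :
    Bracketed.lift dG PG f z.d = dG (Bracketed.lift dG PG f z) := by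
  obtain ⟨a⟩ := z
  rfl

theorem Bracketed.lift_P (dG PG : G → G) (f : X → G) (z : Bracketed X) :
    Bracketed.lift dG PG f z.P = PG (Bracketed.lift dG PG f z) := by
  obtain ⟨a⟩ := z
  rfl

theorem Mon.eval_mk (dG PG : G → G) (f : X → G) (a : Multiset (X × Fin (n + 1)))
    (t : List (Multiset (X × Fin (n + 1)))) :
    (⟨a, t⟩ : Mon n X).eval dG PG f = evalWord dG f a * evalTail dG PG f t := rfl

theorem Mon.eval_nil (dG PG : G → G) (f : X → G) (a : Multiset (X × Fin (n + 1))) :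
    (⟨a, []⟩ : Mon n X).eval dG PG f = evalWord dG f a := mul_one _

theorem Mon.eval_cons (dG PG : G → G) (f : X → G) (a : Multiset (X × Fin (n + 1))) (u : Mon n X) :
    (⟨a, u.head :: u.tail⟩ : Mon n X).eval dG PG f = evalWord dG f a * PG (u.eval dG PG f) := rfl

theorem evalWord_add (dG : G → G) (f : X → G) (a b : Multiset (X × Fin (n + 1))) :
    evalWord dG f (a + b) = evalWord dG f a * evalWord dG f b := by
  simp [evalWord]

theorem evalWord_cons (dG : G → G) (f : X → G) (y : X × Fin (n + 1))
    (a : Multiset (X × Fin (n + 1))) :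
    evalWord dG f (y ::ₘ a) = dG^[(y.2 : ℕ)] (f y.1) * evalWord dG f a := by
  simp [evalWord]

theorem evalWord_zero (dG : G → G) (f : X → G) :
    evalWord dG f (0 : Multiset (X × Fin (n + 1))) = 1 := by
  simp [evalWord]

theorem Mon.eval_letter (dG PG : G → G) (f : X → G) (y : X × Fin (n + 1)) :
    (Mon.letter y).eval dG PG f = dG^[(y.2 : ℕ)] (f y.1) := by
  rw [Mon.letter, Mon.eval_nil]
  simp [evalWord]

/-- This lets images of `toBracketed` and of substitutions be computed directly in the target, both
`PartialMon` and `Sha`. -/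
theorem map_mon_eval (φ : G →* H) (dG PG : G → G) (dH PH : H → H) (hd : ∀ g, φ (dG g) = dH (φ g))
    (hP : ∀ g, φ (PG g) = PH (φ g)) (f : X → G) (u : Mon n X) :
    φ (u.eval dG PG f) = u.eval dH PH fun x => φ (f x) := by
  have hiter : ∀ (ℓ : ℕ) (g : G), φ (dG^[ℓ] g) = dH^[ℓ] (φ g) := fun ℓ g =>
    Function.Semiconj.iterate_right hd ℓ g
  have hword : ∀ a : Multiset (X × Fin (n + 1)), φ (evalWord dG f a) =
      evalWord dH (fun x => φ (f x)) a := by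
    intro a
    simp only [evalWord, map_multiset_prod, Multiset.map_map, Function.comp_def, hiter]
  have htail : ∀ t : List (Multiset (X × Fin (n + 1))), φ (evalTail dG PG f t) =
      evalTail dH PH (fun x => φ (f x)) t := by
    intro t
    induction t with
    | nil => exact map_one φ
    | cons a t ih => simp only [evalTail, hP, map_mul, hword, ih]
  rw [Mon.eval, Mon.eval, map_mul, hword, htail]

theorem Mon.eval_partial (u : Mon n X) : u.eval PartialMon.d PartialMon.P
    (fun x => PartialMon.of (Mon.letter (x, 0))) = PartialMon.of u := by
  have hword : ∀ a : Multiset (X × Fin (n + 1)), evalWord PartialMon.d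
      (fun x => PartialMon.of (Mon.letter (x, 0))) a = PartialMon.of (⟨a, []⟩ : Mon n X) := by
    intro a
    induction a using Multiset.induction with
    | empty => exact evalWord_zero _ _
    | cons y a ih =>
      have h := PartialMon.iterate_d_letter (n := n) y.1 0 y.2 (by omega)
      rw [evalWord_cons, ih]
      erw [h]
      rw [PartialMon.of_mul_of _ _ (Or.inl rfl)]
      simp [Mon.letter]
  obtain ⟨a, t⟩ := u
  induction t generalizing a with
  | nil => rw [Mon.eval_nil, hword]
  | cons b t ih =>
    have h := Mon.eval_cons PartialMon.d PartialMon.P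
      (fun x => PartialMon.of (Mon.letter (n := n) (x, 0))) a (⟨b, t⟩ : Mon n X)
    rw [h, ih, hword, PartialMon.P_of, PartialMon.of_mul_of _ _ (Or.inr rfl)]
    simp

theorem Mon.eval_sha {k : Type*} [CommRing k] {lam : k} (u : Mon n X) :
    u.eval (opD (lam := lam)) (opP (lam := lam)) (fun x => mon (Mon.letter (x, 0))) = mon u := by
  have hword : ∀ a : Multiset (X × Fin (n + 1)), evalWord (opD (lam := lam))
      (fun x => mon (Mon.letter (x, 0))) a = mon (⟨a, []⟩ : Mon n X) := by
    intro a
    induction a using Multiset.induction with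
    | empty => exact evalWord_zero _ _
    | cons y a ih =>
      have h := iterate_opD_letter (lam := lam) (n := n) y.1 0 y.2 (by omega)
      rw [dif_pos (by omega)] at h
      rw [evalWord_cons, ih]
      erw [h]
      rw [mon_cons_word]
      simp
  obtain ⟨a, t⟩ := u
  induction t generalizing a with
  | nil => rw [Mon.eval_nil, hword]
  | cons b t ih =>
    have h := Mon.eval_cons (opD (lam := lam)) (opP (lam := lam))
      (fun x => mon (Mon.letter (n := n) (x, 0))) a (⟨b, t⟩ : Mon n X)
    rw [h, ih, hword, mon_cons]

/-- The DRB monomial represented by a bracketed monomial, if there is one. -/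
noncomputable def Bracketed.toPartial (n : ℕ) : Bracketed X →* PartialMon n X :=
  Bracketed.lift PartialMon.d PartialMon.P fun x => PartialMon.of (Mon.letter (x, 0))

theorem Bracketed.toPartial_toBracketed (w : Mon n X) :
    Bracketed.toPartial n (toBracketed w) = PartialMon.of w := by
  rw [toBracketed, Bracketed.toPartial, map_mon_eval _ _ _ _ _ (Bracketed.lift_d _ _ _)
    (Bracketed.lift_P _ _ _)]
  exact Mon.eval_partial w

theorem toBracketed_mul (u v : Mon n X) (h : v.tail = [] ∨ u.tail = []) :
    toBracketed u * toBracketed v =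
      toBracketed (⟨u.head + v.head, v.tail ++ u.tail⟩ : Mon n X) := by
  simp only [toBracketed, Mon.eval, evalWord_add]
  rcases h with h | h <;> simp [h, evalTail, mul_left_comm, mul_comm]

theorem toBracketed_P (u : Mon n X) :
    (toBracketed u).P = toBracketed (⟨0, u.head :: u.tail⟩ : Mon n X) := by
  rw [toBracketed, toBracketed, Mon.eval_cons, evalWord_zero, one_mul]

theorem toBracketed_letter (y : X × Fin (n + 1)) :
    toBracketed (Mon.letter y) = Bracketed.d^[(y.2 : ℕ)] (Bracketed.var y.1) :=
  Mon.eval_letter _ _ _ _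

/-- A defined value forces defined values on all subexpressions, and there the partial operations
agree with the bracketed ones. Hence equations with a DRB monomial in the quotient monoid can be
checked in `PartialMon`. -/
theorem eq_toBracketed_of_toPartial {z : Bracketed X} {w : Mon n X}
    (h : Bracketed.toPartial n z = PartialMon.of w) : toBracketed w = z := by
  obtain ⟨a⟩ := z
  induction a generalizing w with
  | var x =>
    have h' := PartialMon.of_injective h
    rw [← h', toBracketed_letter]
    rfl
  | one =>
    have h' : w = ⟨0, []⟩ := (PartialMon.of_injective h).symm
    rw [h', toBracketed, Mon.eval_nil, evalWord_zero]
    rfl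
  | mul a b iha ihb =>
    have h' : Bracketed.toPartial n (Quot.mk _ a) * Bracketed.toPartial n (Quot.mk _ b) =
      PartialMon.of w := h
    obtain ⟨u, v, hu, hv, huv, rfl⟩ := PartialMon.mul_eq_of h'
    rw [← toBracketed_mul u v huv, iha hu, ihb hv]
    rfl
  | d a ih =>
    have h' : PartialMon.d (Bracketed.toPartial n (Quot.mk _ a)) = PartialMon.of w := h
    obtain ⟨x, i, hi, hu, rfl⟩ := PartialMon.d_eq_of h'
    have := ih hu
    rw [toBracketed_letter] at this ⊢
    rw [Function.iterate_succ_apply', this]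
    rfl
  | P a ih =>
    have h' : PartialMon.P (Bracketed.toPartial n (Quot.mk _ a)) = PartialMon.of w := h
    obtain ⟨u, hu, rfl⟩ := PartialMon.P_eq_of h'
    rw [← toBracketed_P, ih hu]
    rfl

theorem toBracketed_eq_iff {z : Bracketed X} {w : Mon n X} :
    toBracketed w = z ↔ Bracketed.toPartial n z = PartialMon.of w :=
  ⟨fun h => h ▸ Bracketed.toPartial_toBracketed w, eq_toBracketed_of_toPartial⟩

end Evaluation

/-! ### Position of the star -/

section Star

variable {X : Type*} {n : ℕ}

/-- A word on `Δ_n X` as a word on `Δ_n (X ∪ {⋆})`. -/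
def optWord (c : Multiset (X × Fin (n + 1))) : Multiset (Option X × Fin (n + 1)) :=
  c.map fun y => (some y.1, y.2)

/-- The number of letters of the form `⋆^{(ℓ)}`. -/
def starCount (q : Mon n (Option X)) : ℕ :=
  ((q.head :: q.tail).map (Multiset.countP fun y => y.1.isNone)).sum

theorem starCount_mk (a : Multiset (Option X × Fin (n + 1)))
    (t : List (Multiset (Option X × Fin (n + 1)))) : starCount ⟨a, t⟩ =
      a.countP (fun y => y.1.isNone) + (t.map (Multiset.countP fun y => y.1.isNone)).sum := by
  simp [starCount]

theorem countP_optWord (c : Multiset (X × Fin (n + 1))) :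
    (optWord c).countP (fun y => y.1.isNone) = 0 := by
  rw [optWord, Multiset.countP_eq_zero]
  intro y hy
  obtain ⟨z, -, rfl⟩ := Multiset.mem_map.1 hy
  simp

theorem exists_optWord_of_countP (a : Multiset (Option X × Fin (n + 1)))
    (h : a.countP (fun y => y.1.isNone) = 0) : ∃ c, a = optWord c := by
  induction a using Multiset.induction with
  | empty => exact ⟨0, rfl⟩
  | cons y a ih =>
    obtain ⟨_ | x, i⟩ := y
    · simp at h
    · obtain ⟨c, rfl⟩ := ih (by simpa using h)
      exact ⟨(x, i) ::ₘ c, by simp [optWord]⟩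

theorem exists_cons_optWord_of_countP (a : Multiset (Option X × Fin (n + 1)))
    (h : a.countP (fun y => y.1.isNone) = 1) : ∃ ℓ c, a = (none, ℓ) ::ₘ optWord c := by
  have hpos : 0 < a.countP (fun y => y.1.isNone) := by omega
  obtain ⟨⟨o, ℓ⟩, hy, ho⟩ := Multiset.countP_pos.1 hpos
  obtain ⟨b, rfl⟩ := Multiset.exists_cons_of_mem hy
  obtain rfl : o = none := by simpa using ho
  obtain ⟨c, rfl⟩ := exists_optWord_of_countP b (by simpa using h)
  exact ⟨ℓ, c, rfl⟩

theorem exists_map_optWord_of_sum (t : List (Multiset (Option X × Fin (n + 1))))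
    (h : (t.map (Multiset.countP fun y => y.1.isNone)).sum = 0) :
    ∃ r : List (Multiset (X × Fin (n + 1))), t = r.map optWord := by
  induction t with
  | nil => exact ⟨[], rfl⟩
  | cons a t ih =>
    rw [List.map_cons, List.sum_cons, Nat.add_eq_zero_iff] at h
    obtain ⟨r, rfl⟩ := ih h.2
    obtain ⟨c, rfl⟩ := exists_optWord_of_countP a h.1
    exact ⟨c :: r, rfl⟩

theorem sum_map_optWord (r : List (Multiset (X × Fin (n + 1)))) :
    ((r.map optWord).map (Multiset.countP fun y => y.1.isNone)).sum = 0 := by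
  induction r with
  | nil => rfl
  | cons a r ih =>
    rw [List.map_cons, List.map_cons, List.sum_cons, ih, countP_optWord]

/-- The star lies in the outermost word or under the outermost `P`. -/
theorem star_cases (q : Mon n (Option X)) (h : starCount q = 1) :
    (∃ (ℓ : Fin (n + 1)) (c : Multiset (X × Fin (n + 1)))
      (r : List (Multiset (X × Fin (n + 1)))), q = ⟨(none, ℓ) ::ₘ optWord c, r.map optWord⟩) ∨
      ∃ (c : Multiset (X × Fin (n + 1))) (q' : Mon n (Option X)), starCount q' = 1 ∧
        q = ⟨optWord c, q'.head :: q'.tail⟩ := by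
  obtain ⟨a, t⟩ := q
  rw [starCount_mk] at h
  by_cases ha : a.countP (fun y => y.1.isNone) = 0
  · right
    obtain ⟨c, rfl⟩ := exists_optWord_of_countP a ha
    rw [ha, zero_add] at h
    cases t with
    | nil => simp at h
    | cons b t => exact ⟨c, ⟨b, t⟩, h, rfl⟩
  · left
    obtain ⟨ℓ, c, rfl⟩ := exists_cons_optWord_of_countP a (by omega)
    obtain ⟨r, rfl⟩ := exists_map_optWord_of_sum t (by omega)
    exact ⟨ℓ, c, r, rfl⟩

variable {G : Type*} [CommMonoid G] (dG PG : G → G) (f : X → G) (g : G)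

theorem evalWord_optWord (c : Multiset (X × Fin (n + 1))) :
    evalWord dG (fun o : Option X => o.elim g f) (optWord c) = evalWord dG f c := by
  simp [evalWord, optWord, Multiset.map_map, Function.comp_def]

theorem evalTail_map_optWord (r : List (Multiset (X × Fin (n + 1)))) :
    evalTail dG PG (fun o : Option X => o.elim g f) (r.map optWord) = evalTail dG PG f r := by
  induction r with
  | nil => rfl
  | cons a r ih => simp only [List.map_cons, evalTail, evalWord_optWord, ih]

theorem eval_star_head (ℓ : Fin (n + 1)) (c : Multiset (X × Fin (n + 1)))
    (r : List (Multiset (X × Fin (n + 1)))) :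
    (⟨(none, ℓ) ::ₘ optWord c, r.map optWord⟩ : Mon n (Option X)).eval dG PG
      (fun o => o.elim g f) = (⟨c, r⟩ : Mon n X).eval dG PG f * dG^[(ℓ : ℕ)] g := by
  rw [Mon.eval_mk, Mon.eval_mk, evalWord_cons, evalWord_optWord, evalTail_map_optWord, mul_assoc,
    mul_comm]
  rfl

theorem eval_star_tail (c : Multiset (X × Fin (n + 1))) (q : Mon n (Option X)) :
    (⟨optWord c, q.head :: q.tail⟩ : Mon n (Option X)).eval dG PG (fun o => o.elim g f) =
      (⟨c, []⟩ : Mon n X).eval dG PG f * PG (q.eval dG PG fun o => o.elim g f) := by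
  rw [Mon.eval_cons, evalWord_optWord, Mon.eval_nil]

/-- The induction measure for `⋆`-monomials is the number of nested `P`. -/
theorem star_induction {p : Mon n (Option X) → Prop}
    (head : ∀ (ℓ : Fin (n + 1)) (c : Multiset (X × Fin (n + 1)))
      (r : List (Multiset (X × Fin (n + 1)))), p ⟨(none, ℓ) ::ₘ optWord c, r.map optWord⟩)
    (tail : ∀ (c : Multiset (X × Fin (n + 1))) (q : Mon n (Option X)), starCount q = 1 →
      p q → p ⟨optWord c, q.head :: q.tail⟩)
    (q : Mon n (Option X)) (h : starCount q = 1) : p q := by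
  induction hm : q.tail.length using Nat.strong_induction_on generalizing q with
  | _ m ih =>
    rcases star_cases q h with ⟨ℓ, c, r, rfl⟩ | ⟨c, q', hq', rfl⟩
    · exact head ℓ c r
    · exact tail c q' hq' (ih q'.tail.length (by simp [← hm]) q' hq' rfl)

theorem starCount_head (ℓ : Fin (n + 1)) (c : Multiset (X × Fin (n + 1)))
    (r : List (Multiset (X × Fin (n + 1)))) :
    starCount (⟨(none, ℓ) ::ₘ optWord c, r.map optWord⟩ : Mon n (Option X)) = 1 := by
  rw [starCount_mk, sum_map_optWord, Multiset.countP_cons, countP_optWord]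
  simp

theorem starCount_tail (c : Multiset (X × Fin (n + 1))) (q : Mon n (Option X)) :
    starCount (⟨optWord c, q.head :: q.tail⟩ : Mon n (Option X)) = starCount q := by
  rw [starCount_mk, countP_optWord, zero_add]
  rfl

end Star

/-! ### Substitution into star monomials -/

section Substitution

variable {k : Type*} [CommRing k] {lam : k} {n : ℕ} {X : Type*}

/-- The DRB monomial represented by `q|_u`, if there is one. -/
noncomputable def substPartial (q : Mon n (Option X)) (u : Mon n X) : PartialMon n X :=
  q.eval PartialMon.d PartialMon.P
    (fun o => o.elim (PartialMon.of u) fun x => PartialMon.of (Mon.letter (x, 0)))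

/-- The value of `q|_s` in `k𝔅(Δ_n X)`. -/
noncomputable def substSha (q : Mon n (Option X)) (s : Sha lam n X) : Sha lam n X :=
  q.eval opD opP (fun o => o.elim s fun x => mon (Mon.letter (x, 0)))

theorem substPartial_head (ℓ : Fin (n + 1)) (c : Multiset (X × Fin (n + 1)))
    (r : List (Multiset (X × Fin (n + 1)))) (u : Mon n X) :
    substPartial ⟨(none, ℓ) ::ₘ optWord c, r.map optWord⟩ u =
      PartialMon.of ⟨c, r⟩ * PartialMon.d^[(ℓ : ℕ)] (PartialMon.of u) := by
  rw [substPartial, eval_star_head, Mon.eval_partial]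

theorem substPartial_tail (c : Multiset (X × Fin (n + 1))) (q : Mon n (Option X)) (u : Mon n X) :
    substPartial ⟨optWord c, q.head :: q.tail⟩ u =
      PartialMon.of ⟨c, []⟩ * PartialMon.P (substPartial q u) := by
  rw [substPartial, eval_star_tail, Mon.eval_partial, substPartial]

theorem substSha_head (ℓ : Fin (n + 1)) (c : Multiset (X × Fin (n + 1)))
    (r : List (Multiset (X × Fin (n + 1)))) (s : Sha lam n X) :
    substSha ⟨(none, ℓ) ::ₘ optWord c, r.map optWord⟩ s = mon ⟨c, r⟩ * opD^[(ℓ : ℕ)] s := by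
  rw [substSha, eval_star_head, Mon.eval_sha]

theorem substSha_tail (c : Multiset (X × Fin (n + 1))) (q : Mon n (Option X)) (s : Sha lam n X) :
    substSha ⟨optWord c, q.head :: q.tail⟩ s = mon ⟨c, []⟩ * opP (substSha q s) := by
  rw [substSha, eval_star_tail, Mon.eval_sha, substSha]

theorem toPartial_subst (q : StarMon n X) (u : Mon n X) :
    Bracketed.toPartial n (q.subst u) = substPartial q.1 u := by
  rw [StarMon.subst, map_mon_eval (Bracketed.toPartial n) _ _ _ _ (Bracketed.lift_d _ _ _)
    (Bracketed.lift_P _ _ _), substPartial]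
  congr 1
  ext1 o
  cases o with
  | none => exact Bracketed.toPartial_toBracketed u
  | some x => rfl

theorem toBracketed_eq_subst_iff {q : StarMon n X} {u w : Mon n X} :
    toBracketed w = q.subst u ↔ substPartial q.1 u = PartialMon.of w := by
  rw [toBracketed_eq_iff, toPartial_subst]

theorem red_of (z : Bracketed X) : red (lam := lam) (n := n) (MonoidAlgebra.of k (Bracketed X) z) =
    Bracketed.lift (opD (lam := lam)) (opP (lam := lam)) (fun x => mon (Mon.letter (x, 0))) z := by
  rw [red, MonoidAlgebra.lift_of]

theorem red_substPoly_mon (q : StarMon n X) (u : Mon n X) :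
    red (lam := lam) (q.substPoly (mon (lam := lam) u)) = substSha q.1 (mon u) := by
  rw [StarMon.substPoly, extend_mon, red_of, StarMon.subst, map_mon_eval _ _ _ _ _
    (Bracketed.lift_d _ _ _) (Bracketed.lift_P _ _ _), substSha]
  congr 1
  ext1 o
  cases o with
  | none =>
    change Bracketed.lift _ _ _ (toBracketed u) = mon u
    rw [toBracketed, map_mon_eval _ _ _ _ _ (Bracketed.lift_d _ _ _) (Bracketed.lift_P _ _ _)]
    exact Mon.eval_sha u
  | some x => rfl

/-- With exactly one star, no two copies of `s` are ever multiplied. Linearity allows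
`red_substPoly` to be checked on monomials. -/
theorem exists_linearMap_substSha (q : Mon n (Option X)) (h : starCount q = 1) :
    ∃ T : Sha lam n X →ₗ[k] Sha lam n X, ∀ s, T s = substSha q s := by
  refine star_induction (p := fun q => ∃ T : Sha lam n X →ₗ[k] Sha lam n X,
    ∀ s, T s = substSha q s) ?_ ?_ q h
  · intro ℓ c r
    refine ⟨(LinearMap.mulLeft k (mon ⟨c, r⟩)).comp ((opD : Module.End k (Sha lam n X)) ^ (ℓ : ℕ)),
      fun s => ?_⟩
    rw [substSha_head, iterate_opD_eq_pow]
    rfl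
  · rintro c q - ⟨T, hT⟩
    refine ⟨(LinearMap.mulLeft k (mon ⟨c, []⟩)).comp (opP.comp T), fun s => ?_⟩
    rw [substSha_tail, ← hT]
    rfl

theorem red_substPoly (q : StarMon n X) (s : Sha lam n X) :
    red (q.substPoly s) = substSha q.1 s := by
  obtain ⟨T, hT⟩ := exists_linearMap_substSha (lam := lam) q.1 q.2
  rw [← hT]
  induction s using Sha.induction_mon with
  | zero => simp
  | add f g hf hg => simp only [map_add, hf, hg]
  | smul c f hf => simp only [map_smul, hf]
  | mon u => rw [red_substPoly_mon, hT]

end Substitution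

/-! ### Inductive description of the normal substitutions -/

section NormalForms

variable {k : Type*} [CommRing k] {lam : k} {n : ℕ} {X : Type*} [LinearOrder X]

/-- The elements `s ∈ S`, and the derivatives `d^ℓ(s)` for which `d^ℓ(s̄)` is a letter, together
with their leading monomials. -/
inductive Core (S : Set (Sha lam n X)) : Mon n X → Sha lam n X → Prop
  | base (s : Sha lam n X) (hs : s ∈ S) : Core S (lead s) s
  | deriv (s : Sha lam n X) (hs : s ∈ S) (x : X) (i ℓ : ℕ) (hi : i + ℓ < n + 1)
      (h : lead s = Mon.letter (x, ⟨i, by omega⟩)) :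
      Core S (Mon.letter (x, ⟨i + ℓ, hi⟩)) (opD^[ℓ] s)

/-- `NormalForm S w g`: `g` is the value of a normal `q|_s` with `s ∈ S` and `w = q|_{s̄}`. -/
inductive NormalForm (S : Set (Sha lam n X)) : Mon n X → Sha lam n X → Prop
  | head (c : Multiset (X × Fin (n + 1))) (r : List (Multiset (X × Fin (n + 1)))) (u : Mon n X)
      (t : Sha lam n X) (ht : Core S u t) (h : u.tail = [] ∨ r = []) :
      NormalForm S ⟨c + u.head, u.tail ++ r⟩ (mon ⟨c, r⟩ * t)
  | tail (c : Multiset (X × Fin (n + 1))) (w : Mon n X) (g : Sha lam n X) (h : NormalForm S w g) :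
      NormalForm S ⟨c, w.head :: w.tail⟩ (mon ⟨c, []⟩ * opP g)

variable {S : Set (Sha lam n X)}

/-- The star lies in the outermost word, as `⋆^{(ℓ)}`, or under `P`. In the first case `ℓ = 0` gives
`s` itself, and `ℓ ≥ 1` forces `s̄` to be a letter, which are the two kinds of `Core`. The converse
is `NormalForm.exists_subst`. -/
theorem NormalForm.of_substPartial {s : Sha lam n X} (hs : s ∈ S) (q : Mon n (Option X))
    (hq : starCount q = 1) : ∀ w : Mon n X, substPartial q (lead s) = PartialMon.of w →
      NormalForm S w (substSha q s) := by
  refine star_induction (p := fun q => ∀ w : Mon n X,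
    substPartial q (lead s) = PartialMon.of w → NormalForm S w (substSha q s)) ?_ ?_ q hq
  · intro ℓ c r w h
    rw [substPartial_head] at h
    rw [substSha_head]
    obtain ⟨u, v, hu, hv, huv, rfl⟩ := PartialMon.mul_eq_of h
    obtain rfl := PartialMon.of_injective hu
    refine NormalForm.head c r v _ ?_ huv
    rcases Nat.eq_zero_or_pos (ℓ : ℕ) with h0 | hpos
    · rw [h0] at hv ⊢
      rw [← PartialMon.of_injective hv]
      exact Core.base s hs
    · obtain ⟨x, i, hi, h1, rfl⟩ := PartialMon.iterate_d_eq_of hpos hv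
      exact Core.deriv s hs x i ℓ hi (PartialMon.of_injective h1)
  · intro c q _ ih w h
    rw [substPartial_tail] at h
    rw [substSha_tail]
    obtain ⟨u, v, hu, hv, -, rfl⟩ := PartialMon.mul_eq_of h
    obtain rfl := PartialMon.of_injective hu
    obtain ⟨w, hw, rfl⟩ := PartialMon.P_eq_of hv
    have := NormalForm.tail c w _ (ih w hw)
    simpa using this

theorem NormalForm.of_subst (q : StarMon n X) {s : Sha lam n X} (hs : s ∈ S) {w : Mon n X}
    (h : toBracketed w = q.subst (lead s)) : NormalForm S w (red (q.substPoly s)) := by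
  rw [red_substPoly]
  exact NormalForm.of_substPartial hs q.1 q.2 w (toBracketed_eq_subst_iff.1 h)

theorem Core.exists_iterate {u : Mon n X} {t : Sha lam n X} (h : Core S u t) :
    ∃ s ∈ S, ∃ ℓ : Fin (n + 1), t = opD^[(ℓ : ℕ)] s ∧
      PartialMon.d^[(ℓ : ℕ)] (PartialMon.of (lead s)) = PartialMon.of u := by
  cases h with
  | base _ hs => exact ⟨t, hs, 0, rfl, rfl⟩
  | deriv s hs x i ℓ hi h =>
    refine ⟨s, hs, ⟨ℓ, by omega⟩, rfl, ?_⟩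
    rw [h]
    exact PartialMon.iterate_d_letter x i ℓ hi

theorem NormalForm.exists_subst {w : Mon n X} {g : Sha lam n X} (h : NormalForm S w g) :
    ∃ (q : StarMon n X) (s : Sha lam n X), s ∈ S ∧ toBracketed w = q.subst (lead s) ∧
      g = red (q.substPoly s) := by
  simp only [toBracketed_eq_subst_iff, red_substPoly]
  induction h with
  | head c r u t ht hur =>
    obtain ⟨s, hs, ℓ, rfl, hu⟩ := ht.exists_iterate
    refine ⟨⟨⟨(none, ℓ) ::ₘ optWord c, r.map optWord⟩, starCount_head ℓ c r⟩, s, hs, ?_, ?_⟩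
    · rw [substPartial_head, hu, PartialMon.of_mul_of _ _ hur]
    · rw [substSha_head]
  | tail c w g _ ih =>
    obtain ⟨q, s, hs, hw, rfl⟩ := ih
    refine ⟨⟨⟨optWord c, q.1.head :: q.1.tail⟩, (starCount_tail c q.1).trans q.2⟩, s, hs, ?_, ?_⟩
    · rw [substPartial_tail, hw, PartialMon.P_of, PartialMon.of_mul_of _ _ (Or.inr rfl)]
      simp
    · rw [substSha_tail]

end NormalForms

/-! ### Leading monomials and bounded spans -/

section Leading

variable {k : Type*} [CommRing k] {lam : k} {n : ℕ} {X : Type*}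

theorem Sha.sum_coords (f : Sha lam n X) :
    ((Sha.coords f).sum fun v c => c • (mon v : Sha lam n X)) = f := by
  apply Sha.coords.injective
  rw [map_finsuppSum]
  simp only [map_smul, mon, LinearEquiv.apply_symm_apply, Finsupp.smul_single, smul_eq_mul,
    mul_one]
  exact Finsupp.sum_single _

theorem Sha.mem_of_forall_mon_mem {N : Submodule k (Sha lam n X)} {f : Sha lam n X}
    (h : ∀ v, Sha.coords f v ≠ 0 → mon v ∈ N) : f ∈ N := by
  rw [← Sha.sum_coords f]
  exact Submodule.sum_mem _ fun v hv => N.smul_mem _ (h v (Finsupp.mem_support_iff.1 hv))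

open Classical in
theorem coords_mon (u v : Mon n X) :
    Sha.coords (mon u : Sha lam n X) v = if u = v then (1 : k) else 0 := by
  rw [mon, LinearEquiv.apply_symm_apply, Finsupp.single_apply]

theorem map_mem_of_mem_span {T : Sha lam n X →ₗ[k] Sha lam n X} {s : Set (Sha lam n X)}
    {N : Submodule k (Sha lam n X)} (h : ∀ x ∈ s, T x ∈ N) {g : Sha lam n X}
    (hg : g ∈ Submodule.span k s) : T g ∈ N :=
  (Submodule.span_le (p := N.comap T)).2 h hg

theorem support_nonempty {f : Sha lam n X} (hf : f ≠ 0) : (Sha.coords f).support.Nonempty := by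
  rw [Finsupp.support_nonempty_iff]
  intro h
  exact hf (Sha.coords.injective (h.trans (map_zero _).symm))

variable [LinearOrder X]

/-- The combinations of monomials smaller than `w`. -/
noncomputable def lower (w : Mon n X) : Submodule k (Sha lam n X) :=
  Submodule.span k (mon '' Set.Iio w)

theorem mon_mem_lower {v w : Mon n X} (h : v < w) : (mon v : Sha lam n X) ∈ lower w :=
  Submodule.subset_span ⟨v, h, rfl⟩

theorem map_mem_of_mem_lower {T : Sha lam n X →ₗ[k] Sha lam n X} {w : Mon n X}
    {N : Submodule k (Sha lam n X)} (h : ∀ v < w, T (mon v) ∈ N) {g : Sha lam n X}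
    (hg : g ∈ lower w) : T g ∈ N := by
  refine map_mem_of_mem_span ?_ hg
  rintro _ ⟨v, hv, rfl⟩
  exact h v hv

theorem lower_mono {v w : Mon n X} (h : v ≤ w) :
    (lower v : Submodule k (Sha lam n X)) ≤ lower w :=
  Submodule.span_mono (Set.image_mono (Set.Iio_subset_Iio h))

theorem coords_eq_zero_of_mem_lower {w : Mon n X} {f : Sha lam n X} (hf : f ∈ lower w)
    {v : Mon n X} (hv : ¬ v < w) : Sha.coords f v = 0 := by
  refine Submodule.span_induction (p := fun f _ => Sha.coords f v = 0) ?_ ?_ ?_ ?_ hf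
  · rintro _ ⟨u, hu, rfl⟩
    rw [coords_mon, if_neg]
    rintro rfl
    exact hv hu
  · simp
  · intro f g _ _ hf hg
    simp [hf, hg]
  · intro c f _ hf
    simp [hf]

theorem mem_lower_of_coords {w : Mon n X} {f : Sha lam n X}
    (h : ∀ v, Sha.coords f v ≠ 0 → v < w) : f ∈ lower w :=
  Sha.mem_of_forall_mon_mem fun v hv => mon_mem_lower (h v hv)

theorem coords_lead_ne_zero {f : Sha lam n X} (hf : f ≠ 0) : Sha.coords f (lead f) ≠ 0 := by
  have h := support_nonempty hf
  rw [lead, dif_pos h]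
  exact Finsupp.mem_support_iff.1 (Finset.max'_mem _ h)

theorem le_lead {f : Sha lam n X} {v : Mon n X} (h : Sha.coords f v ≠ 0) : v ≤ lead f := by
  have hv : v ∈ (Sha.coords f).support := Finsupp.mem_support_iff.2 h
  rw [lead, dif_pos ⟨v, hv⟩]
  exact Finset.le_max' _ _ hv

theorem lead_lt_of_mem_lower {w : Mon n X} {f : Sha lam n X} (hf : f ≠ 0) (h : f ∈ lower w) :
    lead f < w := by
  by_contra hlt
  exact coords_lead_ne_zero hf (coords_eq_zero_of_mem_lower h hlt)

/-- The coordinate at `w` is exactly `c`, so `c` need not be invertible; this is why any commutative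
ring is allowed. -/
theorem lead_eq_of_sub_mem_lower {w : Mon n X} {f : Sha lam n X} {c : k} (hc : c ≠ 0)
    (h : f - c • mon w ∈ lower w) : f ≠ 0 ∧ lead f = w := by
  have hcoord : ∀ v, ¬ v < w → Sha.coords f v = c * Sha.coords (mon w : Sha lam n X) v := by
    intro v hv
    have := coords_eq_zero_of_mem_lower h hv
    rw [map_sub, map_smul, Finsupp.sub_apply, Finsupp.smul_apply, smul_eq_mul, sub_eq_zero] at this
    exact this
  have hw : Sha.coords f w ≠ 0 := by
    rw [hcoord w (lt_irrefl _), coords_mon, if_pos rfl, mul_one]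
    exact hc
  have hf : f ≠ 0 := by
    rintro rfl
    simp at hw
  refine ⟨hf, le_antisymm ?_ (le_lead hw)⟩
  by_contra hlt
  refine coords_lead_ne_zero hf ?_
  rw [hcoord _ (fun h => hlt h.le), coords_mon, if_neg, mul_zero]
  rintro rfl
  exact hlt le_rfl

theorem Monic.sub_mem_lower {s : Sha lam n X} (hs : Monic s) : s - mon (lead s) ∈ lower (lead s) := by
  refine mem_lower_of_coords fun v hv => ?_
  rw [map_sub, Finsupp.sub_apply, coords_mon] at hv
  rcases eq_or_ne (lead s) v with h | h
  · rw [if_pos h, ← h, hs.2, sub_self] at hv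
    exact absurd rfl hv
  · rw [if_neg h, sub_zero] at hv
    exact lt_of_le_of_ne (le_lead hv) h.symm

/-- A monic element exists only over a nonzero ring, so no nontriviality of `k` has to be assumed.
-/
theorem Monic.one_ne_zero {s : Sha lam n X} (hs : Monic s) : (1 : k) ≠ 0 :=
  hs.2 ▸ coords_lead_ne_zero hs.1

theorem mon_mul_mem_lower {u : Mon n X} {g : Sha lam n X} (hg : g ∈ lower u)
    (c : Multiset (X × Fin (n + 1))) (r : List (Multiset (X × Fin (n + 1))))
    (h : u.tail = [] ∨ r = []) :
    mon ⟨c, r⟩ * g ∈ lower (⟨c + u.head, u.tail ++ r⟩ : Mon n X) := by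
  refine map_mem_of_mem_lower (T := LinearMap.mulLeft k (mon ⟨c, r⟩)) (fun v hv => ?_) hg
  rw [LinearMap.mulLeft_apply, mon_mul_mon_of_tail _ _ _ (h.imp_left (Mon.tail_eq_nil_of_lt hv))]
  exact mon_mem_lower (Mon.add_append_lt hv c r)

theorem mon_mul_opP_mem_lower {u : Mon n X} {g : Sha lam n X} (hg : g ∈ lower u)
    (c : Multiset (X × Fin (n + 1))) :
    mon ⟨c, []⟩ * opP g ∈ lower (⟨c, u.head :: u.tail⟩ : Mon n X) := by
  refine map_mem_of_mem_lower (T := (LinearMap.mulLeft k (mon ⟨c, []⟩)).comp opP)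
    (fun v hv => ?_) hg
  rw [LinearMap.comp_apply, LinearMap.mulLeft_apply, ← mon_cons]
  exact mon_mem_lower (Mon.cons_lt_cons hv c)

/-- Only `1` and smaller letters lie below a letter. For `ℓ ≥ 1`, `d^ℓ` kills `1`; on letters it
raises all exponents by `ℓ`, which keeps the order, or gives `0`. -/
theorem iterate_opD_mem_lower {x : X} {j ℓ : ℕ} (hj : j + ℓ < n + 1) {g : Sha lam n X}
    (hg : g ∈ lower (Mon.letter (x, ⟨j, by omega⟩))) :
    opD^[ℓ] g ∈ lower (Mon.letter (x, ⟨j + ℓ, hj⟩)) := by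
  rcases Nat.eq_zero_or_pos ℓ with rfl | hℓ
  · exact hg
  rw [iterate_opD_eq_pow]
  refine map_mem_of_mem_lower (fun v hv => ?_) hg
  rw [← iterate_opD_eq_pow]
  rcases Mon.lt_letter hv with rfl | ⟨⟨y, i, hi⟩, rfl, hlt⟩
  · rw [← one_def, iterate_opD_one _ hℓ]
    exact Submodule.zero_mem _
  · rw [iterate_opD_letter]
    split_ifs with h
    · refine mon_mem_lower (Mon.letter_lt_letter.2 ?_)
      rw [letterKey_lt_iff] at hlt ⊢
      simpa using hlt
    · exact Submodule.zero_mem _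

variable {S : Set (Sha lam n X)}

theorem Core.sub_mem_lower (hS : ∀ s ∈ S, Monic s) {u : Mon n X} {t : Sha lam n X}
    (h : Core S u t) : t - mon u ∈ lower u := by
  cases h with
  | base _ hs => exact (hS _ hs).sub_mem_lower
  | deriv s hs x i ℓ hi h =>
    have h1 := (hS s hs).sub_mem_lower
    rw [h] at h1
    have h2 := iterate_opD_mem_lower hi h1
    rw [iterate_opD_eq_pow, map_sub, ← iterate_opD_eq_pow, ← iterate_opD_eq_pow,
      iterate_opD_letter, dif_pos hi] at h2
    exact h2

/-- Both constructors are linear and strictly monotone on the monomials concerned, so they carry a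
leading term to a leading term and lower terms to lower terms. -/
theorem NormalForm.sub_mem_lower (hS : ∀ s ∈ S, Monic s) {w : Mon n X} {g : Sha lam n X}
    (h : NormalForm S w g) : g - mon w ∈ lower w := by
  induction h with
  | head c r u t ht hur =>
    rw [← mon_mul_mon_of_tail c r u hur, ← mul_sub]
    exact mon_mul_mem_lower (ht.sub_mem_lower hS) c r hur
  | tail c w g _ ih =>
    rw [mon_cons, ← mul_sub, ← map_sub]
    exact mon_mul_opP_mem_lower ih c

theorem NormalForm.exists_mem {w : Mon n X} {g : Sha lam n X} (h : NormalForm S w g) :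
    ∃ s, s ∈ S := by
  obtain ⟨q, s, hs, -⟩ := h.exists_subst
  exact ⟨s, hs⟩

theorem NormalForm.lead_eq (hS : ∀ s ∈ S, Monic s) {w : Mon n X} {g : Sha lam n X}
    (h : NormalForm S w g) : lead g = w := by
  obtain ⟨s, hs⟩ := h.exists_mem
  have h1 := h.sub_mem_lower hS
  rw [← one_smul k (mon w : Sha lam n X)] at h1
  exact (lead_eq_of_sub_mem_lower (hS s hs).one_ne_zero h1).2

/-- The span of the normal `q|_s` with `q|_{s̄} < w`. -/
noncomputable def spanBelow (S : Set (Sha lam n X)) (w : Mon n X) : Submodule k (Sha lam n X) :=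
  Submodule.span k { g | ∃ v, NormalForm S v g ∧ v < w }

/-- The span of the normal `q|_s` with `q|_{s̄} ≤ w`. -/
noncomputable def spanUpTo (S : Set (Sha lam n X)) (w : Mon n X) : Submodule k (Sha lam n X) :=
  Submodule.span k { g | ∃ v, NormalForm S v g ∧ v ≤ w }

/-- The span of the normal `q|_s`. -/
noncomputable def normalSpan (S : Set (Sha lam n X)) : Submodule k (Sha lam n X) :=
  Submodule.span k { g | ∃ v, NormalForm S v g }

theorem NormalForm.mem_spanBelow {v w : Mon n X} {g : Sha lam n X} (h : NormalForm S v g)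
    (hvw : v < w) : g ∈ spanBelow S w :=
  Submodule.subset_span ⟨v, h, hvw⟩

theorem NormalForm.mem_normalSpan {v : Mon n X} {g : Sha lam n X} (h : NormalForm S v g) :
    g ∈ normalSpan S :=
  Submodule.subset_span ⟨v, h⟩

theorem spanUpTo_le_spanBelow {v w : Mon n X} (h : v < w) : spanUpTo S v ≤ spanBelow S w :=
  Submodule.span_mono fun _ ⟨u, hu, huv⟩ => ⟨u, hu, huv.trans_lt h⟩

theorem spanUpTo_mono {v w : Mon n X} (h : v ≤ w) : spanUpTo S v ≤ spanUpTo S w :=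
  Submodule.span_mono fun _ ⟨u, hu, huv⟩ => ⟨u, hu, huv.trans h⟩

theorem spanUpTo_le_normalSpan (w : Mon n X) : spanUpTo S w ≤ normalSpan S :=
  Submodule.span_mono fun _ ⟨u, hu, _⟩ => ⟨u, hu⟩

theorem trivial_iff {h : Sha lam n X} : Trivial S h ↔ h ∈ spanUpTo S (lead h) := by
  rw [Trivial, spanUpTo]
  congr! 3
  ext g
  constructor
  · rintro ⟨q, s, hs, -, ⟨w, hw, hle⟩, rfl⟩
    exact ⟨w, NormalForm.of_subst q hs hw, hle⟩
  · rintro ⟨w, hw, hle⟩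
    obtain ⟨q, s, hs, hq, rfl⟩ := hw.exists_subst
    exact ⟨q, s, hs, ⟨w, hq⟩, ⟨w, hq, hle⟩, rfl⟩

/-- `TrivialBelow` bounds the leading monomial of `q|_s`, whereas `Trivial` bounds `q|_{s̄}`;
monicity of `S` identifies the two. -/
theorem trivialBelow_iff (hS : ∀ s ∈ S, Monic s) {w : Mon n X} {h : Sha lam n X} :
    TrivialBelow S w h ↔ h ∈ spanBelow S w := by
  rw [TrivialBelow, spanBelow]
  congr! 3
  ext g
  constructor
  · rintro ⟨q, s, hs, ⟨v, hv⟩, hlt, rfl⟩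
    have hnf := NormalForm.of_subst q hs hv
    rw [hnf.lead_eq hS] at hlt
    exact ⟨v, hnf, hlt⟩
  · rintro ⟨v, hv, hlt⟩
    have hlead := hv.lead_eq hS
    obtain ⟨q, s, hs, hq, rfl⟩ := hv.exists_subst
    exact ⟨q, s, hs, ⟨v, hq⟩, by rwa [hlead], rfl⟩

end Leading

/-! ### Stability under contexts, and disjoint occurrences -/

section Contexts

variable {k : Type*} [CommRing k] {lam : k} {n : ℕ} {X : Type*} [LinearOrder X]
  {S : Set (Sha lam n X)}

theorem NormalForm.congr {v w : Mon n X} {f g : Sha lam n X} (h : NormalForm S v f) (hvw : v = w)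
    (hfg : f = g) : NormalForm S w g := hvw ▸ hfg ▸ h

theorem NormalForm.cases_eq {w : Mon n X} {g : Sha lam n X} (h : NormalForm S w g) :
    (∃ c r u t, Core S u t ∧ (u.tail = [] ∨ r = []) ∧ w = ⟨c + u.head, u.tail ++ r⟩ ∧
      g = mon ⟨c, r⟩ * t) ∨
    ∃ c w' g', NormalForm S w' g' ∧ w = ⟨c, w'.head :: w'.tail⟩ ∧ g = mon ⟨c, []⟩ * opP g' := by
  cases h with
  | head c r u t ht h => exact Or.inl ⟨c, r, u, t, ht, h, rfl, rfl⟩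
  | tail c w g h => exact Or.inr ⟨c, w, g, h, rfl, rfl⟩

theorem Core.normalForm {u : Mon n X} {t : Sha lam n X} (h : Core S u t) : NormalForm S u t :=
  (NormalForm.head 0 [] u t h (Or.inr rfl)).congr (by simp) (by rw [mon_zero_nil, one_mul])

theorem NormalForm.mon_mul {w : Mon n X} {g : Sha lam n X} (hg : NormalForm S w g)
    (c : Multiset (X × Fin (n + 1))) (r : List (Multiset (X × Fin (n + 1))))
    (h : w.tail = [] ∨ r = []) : NormalForm S ⟨c + w.head, w.tail ++ r⟩ (mon ⟨c, r⟩ * g) := by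
  rcases hg.cases_eq with ⟨c', r', u, t, ht, hur, rfl, rfl⟩ | ⟨c', w', g', hg', rfl, rfl⟩
  · simp only [List.append_eq_nil_iff] at h
    refine (NormalForm.head (c + c') (r' ++ r) u t ht ?_).congr ?_ ?_
    · rcases h with h | rfl
      · exact Or.inl h.1
      · simpa using hur
    · simp [add_assoc]
    · rw [← mul_assoc, mon_mul_mon_of_tail c r ⟨c', r'⟩ (h.imp_left And.right)]
  · obtain rfl : r = [] := by simpa using h
    refine (NormalForm.tail (c + c') w' g' hg').congr (by simp) ?_
    rw [← mul_assoc, mon_add_word]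

theorem mon_mul_mem_spanBelow {w : Mon n X} {g : Sha lam n X} (hg : g ∈ spanBelow S w)
    (c : Multiset (X × Fin (n + 1))) (r : List (Multiset (X × Fin (n + 1))))
    (h : w.tail = [] ∨ r = []) :
    mon ⟨c, r⟩ * g ∈ spanBelow S ⟨c + w.head, w.tail ++ r⟩ := by
  refine map_mem_of_mem_span (T := LinearMap.mulLeft k (mon ⟨c, r⟩)) ?_ hg
  rintro f ⟨v, hv, hlt⟩
  exact (hv.mon_mul c r (h.imp_left (Mon.tail_eq_nil_of_lt hlt))).mem_spanBelow
    (Mon.add_append_lt hlt c r)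

theorem mon_mul_opP_mem_spanBelow {w : Mon n X} {g : Sha lam n X} (hg : g ∈ spanBelow S w)
    (c : Multiset (X × Fin (n + 1))) :
    mon ⟨c, []⟩ * opP g ∈ spanBelow S ⟨c, w.head :: w.tail⟩ := by
  refine map_mem_of_mem_span (T := (LinearMap.mulLeft k (mon ⟨c, []⟩)).comp opP) ?_ hg
  rintro f ⟨v, hv, hlt⟩
  exact (NormalForm.tail c v f hv).mem_spanBelow (Mon.cons_lt_cons hlt c)

/-- Monomials below `v` inherit an empty tail from `v`, so each of them times `t` is still normal.
-/
theorem Core.mul_mem_spanBelow {u v : Mon n X} {t g : Sha lam n X} (ht : Core S u t)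
    (hg : g ∈ lower v) (h : u.tail = [] ∨ v.tail = []) :
    g * t ∈ spanBelow S ⟨v.head + u.head, u.tail ++ v.tail⟩ := by
  refine map_mem_of_mem_lower (T := LinearMap.mulRight k t) (fun v' hv' => ?_) hg
  refine (NormalForm.head v'.head v'.tail u t ht
    (h.imp_right (Mon.tail_eq_nil_of_lt hv'))).mem_spanBelow ?_
  rcases h with h | h
  · have := Mon.add_append_lt hv' u.head []
    simpa [h, add_comm] using this
  · have := Mon.add_append_lt hv' u.head u.tail
    simpa [h, Mon.tail_eq_nil_of_lt hv' h, add_comm] using this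

/-- Two occurrences that do not overlap. -/
theorem Core.sub_mem_spanBelow_of_disjoint (hS : ∀ s ∈ S, Monic s) {u u' : Mon n X}
    {t t' : Sha lam n X} (ht : Core S u t) (ht' : Core S u' t') (hu : u.tail = []) :
    mon u' * t - mon u * t' ∈ spanBelow S ⟨u'.head + u.head, u'.tail⟩ := by
  have h1 := ht.mul_mem_spanBelow (ht'.sub_mem_lower hS) (Or.inl hu)
  have h2 := ht'.mul_mem_spanBelow (ht.sub_mem_lower hS) (Or.inr hu)
  simp only [hu, List.nil_append, List.append_nil] at h1 h2
  rw [add_comm] at h2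
  -- `u' t - u t' = (t - u) t' - (t' - u') t`, and each product on the right has a factor made of
  -- lower terms.
  have := Submodule.sub_mem _ h2 h1
  convert this using 1
  ring

/-- An occurrence in the outermost word and one under the outermost `P`. -/
theorem Core.sub_tail_mem_spanBelow (hS : ∀ s ∈ S, Monic s) {u w : Mon n X}
    {t g : Sha lam n X} (ht : Core S u t) (hg : NormalForm S w g) (hu : u.tail = [])
    (c : Multiset (X × Fin (n + 1))) :
    mon ⟨c, w.head :: w.tail⟩ * t - mon ⟨c + u.head, []⟩ * opP g ∈
      spanBelow S ⟨c + u.head, w.head :: w.tail⟩ := by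
  have h1 := ht.mul_mem_spanBelow (mon_mul_opP_mem_lower (hg.sub_mem_lower hS) c) (Or.inl hu)
  have h2 : mon ⟨c, []⟩ * ((t - mon u) * opP g) ∈
      spanBelow S ⟨c + u.head, w.head :: w.tail⟩ := by
    refine map_mem_of_mem_lower (T := (LinearMap.mulLeft k (mon ⟨c, []⟩)).comp
      (LinearMap.mulRight k (opP g))) (fun v hv => ?_) (ht.sub_mem_lower hS)
    have hv0 := Mon.tail_eq_nil_of_lt hv hu
    have hlt := Mon.add_append_lt hv c (w.head :: w.tail)
    simp only [hv0, hu, List.nil_append] at hlt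
    refine ((NormalForm.tail (c + v.head) w g hg).congr rfl ?_).mem_spanBelow hlt
    simp only [LinearMap.comp_apply, LinearMap.mulLeft_apply, LinearMap.mulRight_apply]
    rw [mon_add_word, ← hv0, mul_assoc]
  simp only [hu, List.nil_append] at h1
  -- With `c`, `u`, `w` read as monomials: `c P(w) t - c u P(g) = c (t - u) P(g) - c P(g - w) t`.
  have := Submodule.sub_mem _ h2 h1
  convert this using 1
  have hu' : (mon u : Sha lam n X) = mon ⟨u.head, []⟩ := by rw [← hu]
  rw [mon_add_word, mon_cons, map_sub, hu']
  ring

end Contexts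

/-! ### Inclusion and derivation compositions in terms of normal forms -/

section Compositions

variable {k : Type*} [CommRing k] {lam : k} {n : ℕ} {X : Type*} [LinearOrder X]
  {S : Set (Sha lam n X)}

theorem IsGroebnerShirshov.sub_mem_of_normalForm (hGS : IsGroebnerShirshov S)
    (hS : ∀ s ∈ S, Monic s) {f : Sha lam n X} (hf : f ∈ S) {g : Sha lam n X}
    (hg : NormalForm S (lead f) g) : f - g ∈ spanBelow S (lead f) := by
  obtain ⟨q, s, hs, hq, rfl⟩ := hg.exists_subst
  exact (trivialBelow_iff hS).1 (hGS.inclusion f hf s hs q hq)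

theorem IsGroebnerShirshov.iterate_opD_mem (hGS : IsGroebnerShirshov S) {s : Sha lam n X}
    (hs : s ∈ S) {ℓ : ℕ} (hℓ : 1 ≤ ℓ) :
    (∃ u, Core S u (opD^[ℓ] s)) ∨ opD^[ℓ] s ∈ spanUpTo S (lead (opD^[ℓ] s)) := by
  by_cases h : ∃ y : X × Fin (n + 1), (y.2 : ℕ) + ℓ ≤ n ∧ lead s = Mon.letter y
  · obtain ⟨⟨x, i, hi⟩, hle, hlead⟩ := h
    exact Or.inl ⟨_, Core.deriv s hs x i ℓ (by simp only at hle; omega) hlead⟩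
  · exact Or.inr (trivial_iff.1 (hGS.derivation s hs ℓ hℓ h))

theorem Core.exists_of_letter {y : X × Fin (n + 1)} {t : Sha lam n X}
    (h : Core S (Mon.letter y) t) : ∃ s ∈ S, ∃ (i m : ℕ) (hi : i + m < n + 1),
      lead s = Mon.letter (y.1, ⟨i, by omega⟩) ∧ y.2 = ⟨i + m, hi⟩ ∧ t = opD^[m] s := by
  generalize hu : Mon.letter y = u at h
  cases h with
  | base _ hs => exact ⟨t, hs, y.2, 0, y.2.2, hu.symm, rfl, rfl⟩
  | deriv s hs x i m hi h =>
    obtain rfl := PartialMon.letter_injective hu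
    exact ⟨s, hs, i, m, hi, h, rfl, rfl⟩

theorem eq_one_of_lead_eq_one {s : Sha lam n X} (hs : Monic s) (h : lead s = Mon.one) : s = 1 := by
  have h1 := hs.sub_mem_lower
  rw [h] at h1
  by_contra hne
  have h2 := lead_lt_of_mem_lower (sub_ne_zero.2 hne) h1
  rw [Mon.lt_iff] at h2
  simp [Mon.one, wordKey_lt_iff] at h2

theorem Core.eq_one (hS : ∀ s ∈ S, Monic s) {t : Sha lam n X} (h : Core S Mon.one t) : t = 1 := by
  generalize hu : (Mon.one : Mon n X) = u at h
  cases h with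
  | base _ hs => exact eq_one_of_lead_eq_one (hS t hs) hu.symm
  | deriv s hs x i m hi h => simp [Mon.one, Mon.letter] at hu

/-- A normal element led by a monomial below a letter is `1`, a single letter (when `1 ∈ S`), or a
core `d^m(s)`. In the last case `d^(ℓ+m)` may kill the leading letter of `s` while other terms
survive; the derivation composition then supplies a representation. -/
theorem IsGroebnerShirshov.iterate_opD_mem_spanBelow (hGS : IsGroebnerShirshov S)
    (hS : ∀ s ∈ S, Monic s) {x : X} {j ℓ : ℕ} (hj : j + ℓ < n + 1) {g : Sha lam n X}
    (hg : g ∈ spanBelow S (Mon.letter (x, ⟨j, by omega⟩))) :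
    opD^[ℓ] g ∈ spanBelow S (Mon.letter (x, ⟨j + ℓ, hj⟩)) := by
  rcases Nat.eq_zero_or_pos ℓ with rfl | hℓ
  · exact hg
  rw [iterate_opD_eq_pow]
  refine map_mem_of_mem_span ?_ hg
  rintro f ⟨v, hv, hlt⟩
  rw [← iterate_opD_eq_pow]
  have hv0 : v.tail = [] := Mon.tail_eq_nil_of_lt hlt rfl
  -- This bounds the leading monomial of `d^ℓ(f)` before any representation is chosen; triviality
  -- mod `[S]` then stays within that bound.
  have hlow : opD^[ℓ] f ∈ lower (Mon.letter (x, ⟨j + ℓ, hj⟩)) := by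
    refine iterate_opD_mem_lower hj ?_
    rw [← sub_add_cancel f (mon v)]
    exact Submodule.add_mem _ (lower_mono hlt.le (hv.sub_mem_lower hS)) (mon_mem_lower hlt)
  rcases hv.cases_eq with ⟨c, r, u, t, ht, -, rfl, rfl⟩ | ⟨c, w, g', -, rfl, -⟩
  swap
  · simp at hv0
  obtain ⟨a, ut⟩ := u
  simp only [List.append_eq_nil_iff] at hv0
  obtain ⟨rfl, rfl⟩ := hv0
  have hone : a = 0 → t = 1 := fun ha => by subst ha; exact ht.eq_one hS
  rcases Mon.lt_letter hlt with h1 | ⟨⟨y, i, hi⟩, hy, hkey⟩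
  · simp only [Mon.one, Mon.mk.injEq, add_eq_zero] at h1
    obtain ⟨⟨rfl, ha⟩, -⟩ := h1
    rw [hone ha, mon_zero_nil, mul_one, iterate_opD_one _ hℓ]
    exact Submodule.zero_mem _
  · simp only [Mon.letter, Mon.mk.injEq, List.append_nil, and_true] at hy
    rcases Multiset.empty_or_exists_mem a with ha | ⟨z, hz⟩
    · have ht1 := hone ha
      subst ha ht1
      rw [add_zero] at hy
      subst hy
      rw [mul_one] at hlow ⊢
      have h2 := iterate_opD_letter (lam := lam) y i ℓ hi
      rw [Mon.letter] at h2
      rw [h2]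
      split_ifs with h3
      -- Here `1` is a core, so every letter is a normal element led by itself.
      · refine ((NormalForm.mon_mul ht.normalForm {(y, ⟨i + ℓ, h3⟩)} [] (Or.inr rfl)).congr
          (w := Mon.letter (y, ⟨i + ℓ, h3⟩)) (by simp [Mon.letter]) (mul_one _)).mem_spanBelow ?_
        rw [Mon.letter_lt_letter]
        rw [letterKey_lt_iff] at hkey ⊢
        simpa using hkey
      · exact Submodule.zero_mem _
    · have hz' : z = (y, ⟨i, hi⟩) := by
        have : z ∈ c + a := Multiset.mem_add.2 (Or.inr hz)
        rw [hy] at this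
        exact Multiset.mem_singleton.1 this
      have hca : c = 0 ∧ a = {(y, ⟨i, hi⟩)} := by
        have hle : ({(y, ⟨i, hi⟩)} : Multiset (X × Fin (n + 1))) ≤ a :=
          Multiset.singleton_le.2 (hz' ▸ hz)
        obtain ⟨b, rfl⟩ := Multiset.le_iff_exists_add.1 hle
        have h3 : c + b = 0 := by
          rw [add_left_comm] at hy
          exact add_eq_left.1 hy
        rw [add_eq_zero] at h3
        simp [h3]
      obtain ⟨rfl, rfl⟩ := hca
      rw [mon_zero_nil, one_mul] at hlow ⊢
      obtain ⟨s, hs, i', m, hi', hlead, -, rfl⟩ := ht.exists_of_letter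
      rw [← Function.iterate_add_apply] at hlow ⊢
      rcases hGS.iterate_opD_mem hs (ℓ := ℓ + m) (by omega) with ⟨u, hu⟩ | h3
      · refine hu.normalForm.mem_spanBelow ?_
        have h4 := hu.normalForm.lead_eq hS
        by_cases h0 : opD^[ℓ + m] s = 0
        · exfalso
          have h5 := hu.sub_mem_lower hS
          rw [← one_smul k (mon u : Sha lam n X)] at h5
          exact (lead_eq_of_sub_mem_lower (hS s hs).one_ne_zero h5).1 h0
        · rw [← h4]
          exact lead_lt_of_mem_lower h0 hlow
      · by_cases h0 : opD^[ℓ + m] s = 0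
        · rw [h0]
          exact Submodule.zero_mem _
        · exact spanUpTo_le_spanBelow (lead_lt_of_mem_lower h0 hlow) h3

end Compositions

/-! ### Least common multiples of commutative words -/

section MultisetLemmas

variable {α : Type*} [DecidableEq α] {a b : Multiset α}

theorem multiset_sub_eq_self_of_disjoint (h : Disjoint a b) : a - b = a := by
  have := Multiset.sub_add_inter a b
  rw [Multiset.inter_eq_zero_iff_disjoint.2 h] at this
  simpa using this

theorem multiset_card_sub_lt_of_not_disjoint (h : ¬ Disjoint a b) :
    Multiset.card (b - a) < Multiset.card b := by
  have h1 := congrArg Multiset.card (Multiset.sub_add_inter b a)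
  have h2 : b ∩ a ≠ 0 := fun h' => h (Multiset.inter_eq_zero_iff_disjoint.1 h').symm
  rw [Multiset.card_add] at h1
  have := Multiset.card_pos.2 h2
  omega

theorem multiset_sub_add_eq_union : b - a + a = a ∪ b := by
  rw [Multiset.union_comm]
  rfl

theorem multiset_union_eq_left (h : b ≤ a) : a ∪ b = a := sup_eq_left.2 h

theorem multiset_union_eq_right (h : a ≤ b) : a ∪ b = b := sup_eq_right.2 h

end MultisetLemmas

/-! ### Two occurrences with the same leading monomial -/

section Ambiguities

variable {k : Type*} [CommRing k] {lam : k} {n : ℕ} {X : Type*} [LinearOrder X]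
  {S : Set (Sha lam n X)}

theorem Core.cases_eq {u : Mon n X} {t : Sha lam n X} (h : Core S u t) :
    (t ∈ S ∧ lead t = u) ∨ ∃ s ∈ S, ∃ (x : X) (i ℓ : ℕ) (hi : i + ℓ < n + 1),
      lead s = Mon.letter (x, ⟨i, by omega⟩) ∧ u = Mon.letter (x, ⟨i + ℓ, hi⟩) ∧
        t = opD^[ℓ] s := by
  cases h with
  | base _ hs => exact Or.inl ⟨hs, rfl⟩
  | deriv s hs x i ℓ hi h => exact Or.inr ⟨s, hs, x, i, ℓ, hi, h, rfl, rfl⟩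

/-- Here `u` divides the leading monomial of `f`, so the difference is an inclusion composition. -/
theorem IsGroebnerShirshov.sub_mem_of_le (hGS : IsGroebnerShirshov S)
    (hS : ∀ s ∈ S, Monic s) {u : Mon n X} {t f : Sha lam n X} (hf : f ∈ S) (ht : Core S u t)
    {q : List (Multiset (X × Fin (n + 1)))} (hq : u.tail ++ q = (lead f).tail)
    (huq : u.tail = [] ∨ q = []) (hle : u.head ≤ (lead f).head) :
    f - mon ⟨(lead f).head - u.head, q⟩ * t ∈ spanBelow S (lead f) := by
  refine hGS.sub_mem_of_normalForm hS hf ?_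
  refine (NormalForm.head ((lead f).head - u.head) q u t ht huq).congr ?_ rfl
  rw [hq, tsub_add_cancel_of_le hle]

/-- With `m = i' - i`, the element `s' - d^m(s)` is an inclusion composition, since `x^{(i')} =
d^m(x^{(i)})`. Applying `d^{ℓ'}` keeps its triviality. -/
theorem IsGroebnerShirshov.iterate_opD_sub_mem (hGS : IsGroebnerShirshov S)
    (hS : ∀ s ∈ S, Monic s) {s s' : Sha lam n X} (hs : s ∈ S) (hs' : s' ∈ S) {x : X}
    {i i' ℓ ℓ' : ℕ} (hi : i + ℓ < n + 1) (hsum : i + ℓ = i' + ℓ') (hle : i ≤ i')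
    (h : lead s = Mon.letter (x, ⟨i, by omega⟩)) (h' : lead s' = Mon.letter (x, ⟨i', by omega⟩)) :
    opD^[ℓ] s - opD^[ℓ'] s' ∈ spanBelow S (Mon.letter (x, ⟨i + ℓ, hi⟩)) := by
  obtain ⟨m, rfl⟩ := Nat.exists_eq_add_of_le hle
  obtain rfl : ℓ = ℓ' + m := by omega
  have h1 := hGS.sub_mem_of_normalForm hS hs'
    ((Core.deriv s hs x i m (by omega) h).normalForm.congr h'.symm rfl)
  rw [h'] at h1
  have h2 := hGS.iterate_opD_mem_spanBelow hS (ℓ := ℓ') (by omega) h1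
  rw [iterate_opD_eq_pow, map_sub, ← iterate_opD_eq_pow, ← iterate_opD_eq_pow,
    ← Function.iterate_add_apply] at h2
  have h3 := Submodule.neg_mem _ h2
  rw [neg_sub] at h3
  simpa only [hsum] using h3

/-- This is the intersection composition at the least common multiple. With `f₀`, `g₀` the head
words, the breadth condition reduces to `|g₀ - f₀| < |g₀| + [f̄ has a P]`, which fails exactly when
`f̄` is a word sharing no letter with `g₀`. -/
theorem IsGroebnerShirshov.mul_sub_mul_mem (hGS : IsGroebnerShirshov S)
    (hS : ∀ s ∈ S, Monic s) {f g : Sha lam n X} (hf : f ∈ S) (hg : g ∈ S)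
    {q : List (Multiset (X × Fin (n + 1)))} (hq : (lead f).tail ++ q = (lead g).tail)
    (hfq : (lead f).tail = [] ∨ q = [])
    (h : ¬ ((lead f).tail = [] ∧ Disjoint (lead f).head (lead g).head)) :
    mon ⟨(lead g).head - (lead f).head, q⟩ * f - mon ⟨(lead f).head - (lead g).head, []⟩ * g ∈
      spanBelow S ⟨(lead f).head ∪ (lead g).head, (lead g).tail⟩ := by
  rw [mul_comm _ f]
  refine (trivialBelow_iff hS).1 (hGS.intersection f hf g hg _ _ _ ⟨by simp [Mon.HasP], ?_, ?_, ?_⟩)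
  · rw [toBracketed_mul _ _ hfq.symm]
    simp only [add_comm (lead f).head, multiset_sub_add_eq_union]
    rcases hfq with h | h
    · rw [h, List.append_nil, ← hq, h, List.nil_append]
    · rw [h, List.nil_append, ← hq, h, List.append_nil]
  · rw [toBracketed_mul _ _ (Or.inr rfl), List.append_nil]
    rfl
  · have h1 : Multiset.card ((lead f).head ∪ (lead g).head) =
        Multiset.card ((lead g).head - (lead f).head) + Multiset.card (lead f).head := by
      rw [← multiset_sub_add_eq_union, Multiset.card_add]
    simp only [Mon.bre, h1]
    by_cases hf0 : (lead f).tail = []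
    · have h2 := multiset_card_sub_lt_of_not_disjoint (fun hd => h ⟨hf0, hd⟩)
      rw [hf0]
      simp only [List.isEmpty_nil, if_true]
      omega
    · have h2 := Multiset.card_le_card
        (tsub_le_self : (lead g).head - (lead f).head ≤ (lead g).head)
      simp only [List.isEmpty_iff, if_neg hf0]
      omega

/-- The composition of two occurrences of leading monomials in their least common multiple. -/
theorem IsGroebnerShirshov.core_sub_mem (hGS : IsGroebnerShirshov S)
    (hS : ∀ s ∈ S, Monic s) {u u' : Mon n X} {t t' : Sha lam n X} (ht : Core S u t)
    (ht' : Core S u' t') {q : List (Multiset (X × Fin (n + 1)))} (hq : u.tail ++ q = u'.tail)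
    (huq : u.tail = [] ∨ q = []) :
    mon ⟨u'.head - u.head, q⟩ * t - mon ⟨u.head - u'.head, []⟩ * t' ∈
      spanBelow S ⟨u.head ∪ u'.head, u'.tail⟩ := by
  by_cases hd : u.tail = [] ∧ Disjoint u.head u'.head
  · obtain ⟨hu, hd⟩ := hd
    have h := ht.sub_mem_spanBelow_of_disjoint hS ht' hu
    rw [hu, List.nil_append] at hq
    have hu' : mon ⟨u.head, []⟩ = (mon u : Sha lam n X) := by rw [← hu]
    rw [← multiset_sub_add_eq_union, multiset_sub_eq_self_of_disjoint hd,
      multiset_sub_eq_self_of_disjoint hd.symm, hq, hu']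
    exact h
  rcases ht.cases_eq with ⟨hs, rfl⟩ | ⟨s, hs, x, i, ℓ, hi, hlead, rfl, rfl⟩
  · rcases ht'.cases_eq with ⟨hs', rfl⟩ | ⟨s', hs', x', i', ℓ', hi', hlead', rfl, rfl⟩
    · exact hGS.mul_sub_mul_mem hS hs hs' hq huq hd
    · obtain ⟨h1, rfl⟩ := List.append_eq_nil_iff.1 hq
      -- A letter that is not coprime to a word divides it, so this overlap is an inclusion.
      have hmem : (x', ⟨i' + ℓ', hi'⟩) ∈ (lead t).head := by
        by_contra hn
        exact hd ⟨h1, by simpa [Mon.letter] using hn⟩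
      have hle : (Mon.letter (x', ⟨i' + ℓ', hi'⟩) : Mon n X).head ≤ (lead t).head :=
        Multiset.singleton_le.2 hmem
      have h2 := hGS.sub_mem_of_le hS hs ht' (q := []) h1.symm (Or.inl rfl) hle
      have h3 : (⟨(lead t).head ∪ (Mon.letter (x', ⟨i' + ℓ', hi'⟩) : Mon n X).head,
          (Mon.letter (x', ⟨i' + ℓ', hi'⟩) : Mon n X).tail⟩ : Mon n X) = lead t := by
        rw [multiset_union_eq_left hle]
        exact Mon.ext rfl h1.symm
      rw [h3, tsub_eq_zero_of_le hle, mon_zero_nil, one_mul]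
      exact h2
  · have hmem : (x, ⟨i + ℓ, hi⟩) ∈ u'.head := by
      by_contra hn
      exact hd ⟨rfl, by simpa [Mon.letter] using hn⟩
    have hle : (Mon.letter (x, ⟨i + ℓ, hi⟩) : Mon n X).head ≤ u'.head :=
      Multiset.singleton_le.2 hmem
    obtain rfl : q = u'.tail := hq
    rw [tsub_eq_zero_of_le hle, mon_zero_nil, one_mul, multiset_union_eq_right hle]
    rcases ht'.cases_eq with ⟨hs', rfl⟩ | ⟨s', hs', x', i', ℓ', hi', hlead', rfl, rfl⟩
    · have h2 := hGS.sub_mem_of_le hS hs' ht (q := (lead t').tail) rfl (Or.inl rfl) hle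
      have h3 := Submodule.neg_mem _ h2
      rwa [neg_sub] at h3
    · have hy := Multiset.mem_singleton.1 hmem
      simp only [Prod.mk.injEq, Fin.mk.injEq] at hy
      obtain ⟨rfl, hsum⟩ := hy
      have hy : (Mon.letter (x, ⟨i' + ℓ', hi'⟩) : Mon n X) = Mon.letter (x, ⟨i + ℓ, hi⟩) := by
        simp only [hsum]
      rw [hy, tsub_self]
      change mon ⟨0, []⟩ * _ - _ ∈ spanBelow S (Mon.letter (x, ⟨i + ℓ, hi⟩))
      rw [mon_zero_nil, one_mul]
      rcases le_total i i' with hii | hii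
      · exact hGS.iterate_opD_sub_mem hS hs hs' hi hsum hii hlead hlead'
      · have h3 := Submodule.neg_mem _
          (hGS.iterate_opD_sub_mem hS hs' hs hi' hsum.symm hii hlead' hlead)
        rw [neg_sub] at h3
        rwa [hy] at h3

/-- The common monomial is the least common multiple of `u` and `u'` times a context `e ⊗ r'`, so
`core_sub_mem` is multiplied by that context. The hypothesis `h` orients the pair so that the tail
of `u` is an initial segment of that of `u'`. -/
theorem IsGroebnerShirshov.head_sub_head_mem_aux (hGS : IsGroebnerShirshov S)
    (hS : ∀ s ∈ S, Monic s) {u u' : Mon n X} {t t' : Sha lam n X} (ht : Core S u t)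
    (ht' : Core S u' t') {c c' : Multiset (X × Fin (n + 1))}
    {r r' : List (Multiset (X × Fin (n + 1)))} (hur : u.tail = [] ∨ r = [])
    (hur' : u'.tail = [] ∨ r' = []) (hc : c + u.head = c' + u'.head)
    (hr : u.tail ++ r = u'.tail ++ r') (h : u.tail = [] ∨ u'.tail ≠ []) :
    mon ⟨c, r⟩ * t - mon ⟨c', r'⟩ * t' ∈ spanBelow S ⟨c + u.head, u.tail ++ r⟩ := by
  obtain ⟨q, hq, huq, rfl⟩ : ∃ q, u.tail ++ q = u'.tail ∧ (u.tail = [] ∨ q = []) ∧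
      r = q ++ r' := by
    by_cases hu : u.tail = []
    · refine ⟨u'.tail, by rw [hu, List.nil_append], Or.inl hu, ?_⟩
      rwa [hu, List.nil_append] at hr
    · obtain rfl := hur.resolve_left hu
      obtain rfl := hur'.resolve_left (h.resolve_left hu)
      simp only [List.append_nil] at hr
      exact ⟨[], by rw [List.append_nil, hr], Or.inr rfl, rfl⟩
  have hle : u'.head - u.head ≤ c := by
    rw [tsub_le_iff_right, hc]
    exact Multiset.le_add_left _ _
  obtain ⟨e, rfl⟩ := Multiset.le_iff_exists_add.1 hle
  rw [add_comm (u'.head - u.head) e] at hc ⊢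
  have hc' : c' = e + (u.head - u'.head) := by
    rw [add_assoc, multiset_sub_add_eq_union, Multiset.union_def, ← add_assoc] at hc
    exact (add_right_cancel hc).symm
  have h1 := mon_mul_mem_spanBelow (hGS.core_sub_mem hS ht ht' hq huq) e r' hur'
  have hq' : q = [] ∨ r' = [] :=
    hur'.imp_left fun h => (List.append_eq_nil_iff.1 (hq.trans h)).2
  rw [mul_sub, ← mul_assoc, ← mul_assoc, mon_mul_mon_of_tail _ _ _ hq',
    mon_mul_mon_of_tail _ _ _ (Or.inl rfl), ← hc'] at h1
  simp only [List.nil_append] at h1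
  rw [add_assoc, multiset_sub_add_eq_union, ← List.append_assoc, hq]
  exact h1

theorem IsGroebnerShirshov.head_sub_head_mem (hGS : IsGroebnerShirshov S)
    (hS : ∀ s ∈ S, Monic s) {u u' : Mon n X} {t t' : Sha lam n X} (ht : Core S u t)
    (ht' : Core S u' t') {c c' : Multiset (X × Fin (n + 1))}
    {r r' : List (Multiset (X × Fin (n + 1)))} (hur : u.tail = [] ∨ r = [])
    (hur' : u'.tail = [] ∨ r' = []) (hc : c + u.head = c' + u'.head)
    (hr : u.tail ++ r = u'.tail ++ r') :
    mon ⟨c, r⟩ * t - mon ⟨c', r'⟩ * t' ∈ spanBelow S ⟨c + u.head, u.tail ++ r⟩ := by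
  by_cases h : u.tail = [] ∨ u'.tail ≠ []
  · exact hGS.head_sub_head_mem_aux hS ht ht' hur hur' hc hr h
  · have h1 := hGS.head_sub_head_mem_aux hS ht' ht hur' hur hc.symm hr.symm
      (Or.inl (by tauto))
    have h2 := Submodule.neg_mem _ h1
    rwa [neg_sub, ← hc, ← hr] at h2

/-- If `u` is a word, the occurrence of `u` and the one under `P` are disjoint. Otherwise `u`
contains the whole factor `P(w)`, and the inner occurrence gives an inclusion composition,
multiplied by `c`. -/
theorem IsGroebnerShirshov.head_sub_tail_mem (hGS : IsGroebnerShirshov S)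
    (hS : ∀ s ∈ S, Monic s) {u w : Mon n X} {t g : Sha lam n X} (ht : Core S u t)
    (hg : NormalForm S w g) {c : Multiset (X × Fin (n + 1))}
    {r : List (Multiset (X × Fin (n + 1)))} (hur : u.tail = [] ∨ r = [])
    (hr : u.tail ++ r = w.head :: w.tail) :
    mon ⟨c, r⟩ * t - mon ⟨c + u.head, []⟩ * opP g ∈ spanBelow S ⟨c + u.head, u.tail ++ r⟩ := by
  by_cases hu : u.tail = []
  · rw [hr]
    obtain rfl : r = w.head :: w.tail := by rwa [hu] at hr
    exact ht.sub_tail_mem_spanBelow hS hg hu c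
  · obtain rfl := hur.resolve_left hu
    rcases ht.cases_eq with ⟨hs, rfl⟩ | ⟨s, hs, x, i, ℓ, hi, hlead, rfl, rfl⟩
    · rw [List.append_nil] at hr
      have h1 := hGS.sub_mem_of_normalForm hS hs
        ((NormalForm.tail (lead t).head w g hg).congr (Mon.ext rfl hr.symm) rfl)
      have h2 := mon_mul_mem_spanBelow h1 c [] (Or.inr rfl)
      rw [mul_sub, ← mul_assoc, ← mon_add_word] at h2
      exact h2
    · exact absurd rfl hu

/-- Two normal `q|_s` with the same leading monomial `w` are congruent modulo `(S, w)`. -/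
theorem IsGroebnerShirshov.normalForm_sub_mem (hGS : IsGroebnerShirshov S)
    (hS : ∀ s ∈ S, Monic s) {w : Mon n X} {g : Sha lam n X} (hg : NormalForm S w g) :
    ∀ g', NormalForm S w g' → g - g' ∈ spanBelow S w := by
  induction hg with
  | head c r u t ht hur =>
    intro g' hg'
    rcases hg'.cases_eq with ⟨c', r', u', t', ht', hur', hw, rfl⟩ | ⟨c', w', g₁, h₁, hw, rfl⟩
    · rw [Mon.mk.injEq] at hw
      exact hGS.head_sub_head_mem hS ht ht' hur hur' hw.1 hw.2
    · rw [Mon.mk.injEq] at hw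
      rw [← hw.1]
      exact hGS.head_sub_tail_mem hS ht h₁ hur hw.2
  | tail c w g hg ih =>
    intro g' hg'
    rcases hg'.cases_eq with ⟨c', r', u', t', ht', hur', hw, rfl⟩ | ⟨c', w', g₁, h₁, hw, rfl⟩
    · rw [Mon.mk.injEq] at hw
      have h1 := Submodule.neg_mem _ (hGS.head_sub_tail_mem hS ht' hg (c := c') hur' hw.2.symm)
      rwa [neg_sub, ← hw.1, ← hw.2] at h1
    · simp only [Mon.mk.injEq, List.cons.injEq] at hw
      obtain ⟨rfl, hw⟩ := hw
      obtain rfl : w = w' := Mon.ext hw.1 hw.2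
      rw [← mul_sub, ← map_sub]
      exact mon_mul_opP_mem_spanBelow (ih g₁ h₁) c

end Ambiguities

/-! ### The span of the normal elements is the differential Rota-Baxter ideal -/

section IdealClosure

variable {k : Type*} [CommRing k] {lam : k} {n : ℕ} {X : Type*} {S : Set (Sha lam n X)}

theorem subset_drbIdeal {s : Sha lam n X} (hs : s ∈ S) : s ∈ drbIdeal S :=
  Submodule.mem_sInf.2 fun _ hI => hI.1 hs

theorem opD_mem_drbIdeal {f : Sha lam n X} (hf : f ∈ drbIdeal S) : opD f ∈ drbIdeal S :=
  Submodule.mem_sInf.2 fun I hI => (hI.2 f (Submodule.mem_sInf.1 hf I hI)).1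

theorem opP_mem_drbIdeal {f : Sha lam n X} (hf : f ∈ drbIdeal S) : opP f ∈ drbIdeal S :=
  Submodule.mem_sInf.2 fun I hI => (hI.2 f (Submodule.mem_sInf.1 hf I hI)).2

theorem iterate_opD_mem_drbIdeal {f : Sha lam n X} (hf : f ∈ drbIdeal S) (ℓ : ℕ) :
    opD^[ℓ] f ∈ drbIdeal S := by
  induction ℓ with
  | zero => exact hf
  | succ ℓ ih =>
    rw [Function.iterate_succ_apply']
    exact opD_mem_drbIdeal ih

variable [LinearOrder X]

theorem NormalForm.mem_drbIdeal {w : Mon n X} {g : Sha lam n X} (h : NormalForm S w g) :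
    g ∈ drbIdeal S := by
  induction h with
  | head c r u t ht hur =>
    obtain ⟨s, hs, ℓ, rfl, -⟩ := ht.exists_iterate
    exact Ideal.mul_mem_left _ _ (iterate_opD_mem_drbIdeal (subset_drbIdeal hs) _)
  | tail c w g _ ih => exact Ideal.mul_mem_left _ _ (opP_mem_drbIdeal ih)

theorem normalSpan_le_drbIdeal : normalSpan S ≤ (drbIdeal S).restrictScalars k :=
  Submodule.span_le.2 fun _ ⟨_, h⟩ => h.mem_drbIdeal

theorem word_mul_mem_normalSpan {g : Sha lam n X} (hg : g ∈ normalSpan S)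
    (c : Multiset (X × Fin (n + 1))) : mon ⟨c, []⟩ * g ∈ normalSpan S := by
  refine map_mem_of_mem_span (T := LinearMap.mulLeft k (mon ⟨c, []⟩)) ?_ hg
  rintro f ⟨v, hv⟩
  exact (hv.mon_mul c [] (Or.inr rfl)).mem_normalSpan

theorem opP_mem_normalSpan {g : Sha lam n X} (hg : g ∈ normalSpan S) : opP g ∈ normalSpan S := by
  refine map_mem_of_mem_span ?_ hg
  rintro f ⟨v, hv⟩
  have := (NormalForm.tail 0 v f hv).mem_normalSpan
  rwa [mon_zero_nil, one_mul] at this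

/-- The multiplication composition enters only where two factors `P(·)` meet; a derived core is led
by a letter and never needs it. -/
theorem IsGroebnerShirshov.mul_core_mem (hGS : IsGroebnerShirshov S) {u : Mon n X}
    {t : Sha lam n X} (ht : Core S u t) (f : Sha lam n X) : f * t ∈ normalSpan S := by
  induction f using Sha.induction_mon with
  | zero =>
    rw [zero_mul]
    exact Submodule.zero_mem _
  | add f g hf hg =>
    rw [add_mul]
    exact Submodule.add_mem _ hf hg
  | smul c f hf =>
    rw [smul_mul_assoc]
    exact Submodule.smul_mem _ _ hf
  | mon v =>
    by_cases h : u.tail = [] ∨ v.tail = []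
    · exact (NormalForm.head v.head v.tail u t ht h).mem_normalSpan
    · rcases ht.cases_eq with ⟨hs, rfl⟩ | ⟨s, hs, x, i, ℓ, hi, hlead, rfl, rfl⟩
      · rw [not_or] at h
        rw [mul_comm]
        exact spanUpTo_le_normalSpan _ (trivial_iff.1 (hGS.multiplication t hs h.1 v h.2))
      · exact absurd (Or.inl rfl) h

/-- The Rota-Baxter identity expands `P(a ⊗ t) P(g)` into `P` of three terms: `(a ⊗ t) P(g)`, with a
shorter multiplier, and `P(a ⊗ t) g` and `(a ⊗ t) g`, where `g` has lost its `P`. Hence an induction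
on the tail of the multiplier inside one on the normal form. -/
theorem IsGroebnerShirshov.mon_mul_normalForm_mem (hGS : IsGroebnerShirshov S) {w : Mon n X}
    {g : Sha lam n X} (hg : NormalForm S w g) : ∀ u : Mon n X, mon u * g ∈ normalSpan S := by
  induction hg with
  | head c r u t ht hur =>
    intro v
    rw [← mul_assoc]
    exact hGS.mul_core_mem ht _
  | tail c w g hg ih =>
    have key : ∀ (t : List (Multiset (X × Fin (n + 1)))) (b : Multiset (X × Fin (n + 1))),
        mon ⟨b, t⟩ * opP g ∈ normalSpan S := by
      intro t
      induction t with
      | nil => exact fun b => word_mul_mem_normalSpan (opP_mem_normalSpan hg.mem_normalSpan) b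
      | cons a t iht =>
        intro b
        rw [mon_cons, mul_assoc, opP_mul_opP]
        refine word_mul_mem_normalSpan (Submodule.add_mem _ (Submodule.add_mem _ ?_ ?_)
          (Submodule.smul_mem _ _ ?_)) b
        · exact opP_mem_normalSpan (iht a)
        · rw [opP_mon]
          exact opP_mem_normalSpan (ih _)
        · exact opP_mem_normalSpan (ih _)
    rintro ⟨b, t⟩
    rw [mul_left_comm]
    exact word_mul_mem_normalSpan (key t b) c

theorem IsGroebnerShirshov.mul_mem_normalSpan (hGS : IsGroebnerShirshov S) (f : Sha lam n X)
    {g : Sha lam n X} (hg : g ∈ normalSpan S) : f * g ∈ normalSpan S := by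
  refine map_mem_of_mem_span (T := LinearMap.mulLeft k f) ?_ hg
  rintro g ⟨v, hv⟩
  rw [LinearMap.mulLeft_apply]
  induction f using Sha.induction_mon with
  | zero =>
    rw [zero_mul]
    exact Submodule.zero_mem _
  | add f f' hf hf' =>
    rw [add_mul]
    exact Submodule.add_mem _ hf hf'
  | smul c f hf =>
    rw [smul_mul_assoc]
    exact Submodule.smul_mem _ _ hf
  | mon u => exact hGS.mon_mul_normalForm_mem hv u

theorem IsGroebnerShirshov.opD_core_mem (hGS : IsGroebnerShirshov S) {u : Mon n X}
    {t : Sha lam n X} (ht : Core S u t) : opD t ∈ normalSpan S := by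
  obtain ⟨s, hs, ℓ, rfl, -⟩ := ht.exists_iterate
  rw [← Function.iterate_succ_apply' (f := opD)]
  rcases hGS.iterate_opD_mem hs (ℓ := (ℓ : ℕ).succ) (by omega) with ⟨v, hv⟩ | h
  · exact hv.normalForm.mem_normalSpan
  · exact spanUpTo_le_normalSpan _ h

/-- Since the span already absorbs products, the Leibniz rule leaves only the inner factor: a core,
or `P(g)`, for which `d(P(g)) = g`. -/
theorem IsGroebnerShirshov.opD_mem_normalSpan (hGS : IsGroebnerShirshov S)
    {g : Sha lam n X} (hg : g ∈ normalSpan S) : opD g ∈ normalSpan S := by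
  refine map_mem_of_mem_span ?_ hg
  rintro f ⟨v, hv⟩
  have hprod : ∀ a b : Sha lam n X, b ∈ normalSpan S → opD b ∈ normalSpan S →
      opD (a * b) ∈ normalSpan S := by
    intro a b hb hdb
    rw [opD_mul]
    exact Submodule.add_mem _ (Submodule.add_mem _ (hGS.mul_mem_normalSpan _ hb)
      (hGS.mul_mem_normalSpan _ hdb)) (Submodule.smul_mem _ _ (hGS.mul_mem_normalSpan _ hdb))
  rcases hv.cases_eq with ⟨c, r, u, t, ht, -, -, rfl⟩ | ⟨c, w', g', hg', -, rfl⟩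
  · exact hprod _ _ ht.normalForm.mem_normalSpan (hGS.opD_core_mem ht)
  · refine hprod _ _ (opP_mem_normalSpan hg'.mem_normalSpan) ?_
    rw [opD_opP]
    exact hg'.mem_normalSpan

theorem IsGroebnerShirshov.drbIdeal_eq (hGS : IsGroebnerShirshov S) :
    (drbIdeal S).restrictScalars k = normalSpan S := by
  refine le_antisymm ?_ normalSpan_le_drbIdeal
  intro f hf
  let I : Ideal (Sha lam n X) :=
    { carrier := normalSpan S
      add_mem' := fun ha hb => Submodule.add_mem _ ha hb
      zero_mem' := Submodule.zero_mem _
      smul_mem' := fun a _ hb => hGS.mul_mem_normalSpan a hb }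
  exact Submodule.mem_sInf.1 hf I ⟨fun s hs => (Core.base s hs).normalForm.mem_normalSpan,
    fun g hg => ⟨hGS.opD_mem_normalSpan hg, opP_mem_normalSpan hg⟩⟩

end IdealClosure

/-! ### Division, and the implications between (a), (b) and (c) -/

section Reduction

variable {k : Type*} [CommRing k] {lam : k} {n : ℕ} {X : Type*} [LinearOrder X]
  {S : Set (Sha lam n X)}

theorem mem_sup_of_le {M : Type*} [AddCommGroup M] [Module k M] {A B C : Submodule k M} (h : A ≤ B)
    {x : M} (hx : x ∈ A ⊔ C) : x ∈ B ⊔ C :=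
  (sup_le_sup_right h C : A ⊔ C ≤ B ⊔ C) hx

theorem exists_normalForm_iff {w : Mon n X} : (∃ g, NormalForm S w g) ↔
    ∃ (q : StarMon n X) (s : Sha lam n X), s ∈ S ∧ Normal q s ∧
      toBracketed w = q.subst (lead s) := by
  constructor
  · rintro ⟨g, hg⟩
    obtain ⟨q, s, hs, hq, -⟩ := hg.exists_subst
    exact ⟨q, s, hs, ⟨w, hq⟩, hq⟩
  · rintro ⟨q, s, hs, -, hq⟩
    exact ⟨_, NormalForm.of_subst q hs hq⟩

theorem mem_irr_iff {w : Mon n X} : w ∈ Irr S ↔ ∀ g, ¬ NormalForm S w g := by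
  rw [Irr, Set.mem_ofPred_eq, ← exists_normalForm_iff, not_exists]

/-- The combinations of monomials in `Irr(S)`. -/
noncomputable def irrSpan (S : Set (Sha lam n X)) : Submodule k (Sha lam n X) :=
  Submodule.span k ((fun w : Mon n X => (mon w : Sha lam n X)) '' Irr S)

theorem mem_irr_of_mem_irrSpan {f : Sha lam n X} (hf : f ∈ irrSpan S) {v : Mon n X}
    (hv : Sha.coords f v ≠ 0) : v ∈ Irr S := by
  by_contra hn
  refine hv (Submodule.span_induction (p := fun f _ => Sha.coords f v = 0) ?_ ?_ ?_ ?_ hf)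
  · rintro _ ⟨u, hu, rfl⟩
    simp only
    rw [coords_mon, if_neg]
    rintro rfl
    exact hn hu
  · simp
  · intro f g _ _ hf hg
    simp [hf, hg]
  · intro c f _ hf
    simp [hf]

/-- A finite sum has a largest bound. Replacing the strict bound by an attained smaller one makes
well-founded induction applicable. -/
theorem eq_zero_or_exists_of_mem_spanBelow {w : Mon n X} {f : Sha lam n X}
    (hf : f ∈ spanBelow S w) : f = 0 ∨ ∃ v < w, f ∈ spanUpTo S v := by
  refine Submodule.span_induction (p := fun f _ => f = 0 ∨ ∃ v < w, f ∈ spanUpTo S v)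
    ?_ (Or.inl rfl) ?_ ?_ hf
  · rintro g ⟨v, hg, hv⟩
    exact Or.inr ⟨v, hv, Submodule.subset_span ⟨v, hg, le_rfl⟩⟩
  · rintro f g - - (rfl | ⟨v, hv, hf⟩) hg
    · rwa [zero_add]
    · rcases hg with rfl | ⟨v', hv', hg⟩
      · rw [add_zero]
        exact Or.inr ⟨v, hv, hf⟩
      · exact Or.inr ⟨max v v', max_lt hv hv',
          Submodule.add_mem _ (spanUpTo_mono (le_max_left _ _) hf)
            (spanUpTo_mono (le_max_right _ _) hg)⟩
  · rintro c f - (rfl | ⟨v, hv, hf⟩)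
    · exact Or.inl (smul_zero c)
    · exact Or.inr ⟨v, hv, Submodule.smul_mem _ _ hf⟩

theorem exists_mem_spanUpTo_of_mem_normalSpan {f : Sha lam n X} (hf : f ∈ normalSpan S) :
    ∃ v, f ∈ spanUpTo S v := by
  refine Submodule.span_induction (p := fun f _ => ∃ v, f ∈ spanUpTo S v)
    ?_ ⟨Mon.one, Submodule.zero_mem _⟩ ?_ ?_ hf
  · rintro g ⟨v, hg⟩
    exact ⟨v, Submodule.subset_span ⟨v, hg, le_rfl⟩⟩
  · rintro f g - - ⟨v, hf⟩ ⟨v', hg⟩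
    exact ⟨max v v', Submodule.add_mem _ (spanUpTo_mono (le_max_left _ _) hf)
            (spanUpTo_mono (le_max_right _ _) hg)⟩
  · rintro c f - ⟨v, hf⟩
    exact ⟨v, Submodule.smul_mem _ _ hf⟩

theorem spanBelow_le_lower (hS : ∀ s ∈ S, Monic s) (w : Mon n X) : spanBelow S w ≤ lower w := by
  refine Submodule.span_le.2 ?_
  rintro g ⟨v, hg, hv⟩
  rw [← sub_add_cancel g (mon v)]
  exact Submodule.add_mem _ (lower_mono hv.le (hg.sub_mem_lower hS)) (mon_mem_lower hv)

/-- Because the bracketed product is a DRB monomial, one of its two tails is empty and `f u`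
involves no shuffle at the leading term or below it. -/
theorem mul_mon_sub_mem_lower {f : Sha lam n X} (hf : Monic f) {u w : Mon n X}
    (h : toBracketed w = toBracketed (lead f) * toBracketed u) : f * mon u - mon w ∈ lower w := by
  rw [toBracketed_eq_iff, map_mul, Bracketed.toPartial_toBracketed,
    Bracketed.toPartial_toBracketed] at h
  obtain ⟨u', v', hu, hv, huv, rfl⟩ := PartialMon.mul_eq_of h
  obtain rfl := PartialMon.of_injective hu
  obtain rfl := PartialMon.of_injective hv
  have h1 := mon_mul_mem_lower hf.sub_mem_lower u.head u.tail huv.symm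
  have h2 : (⟨u.head + (lead f).head, (lead f).tail ++ u.tail⟩ : Mon n X) =
      ⟨(lead f).head + u.head, u.tail ++ (lead f).tail⟩ := by
    rw [add_comm]
    rcases huv with h | h <;> simp [h]
  rw [mul_sub, mon_mul_mon_of_tail u.head u.tail (lead f) huv.symm, h2, mul_comm] at h1
  exact h1

variable [WellFoundedLT X]

/-- Division: a reducible `w` is traded for the lower terms of a monic normal element led by `w`. No
composition is used. -/
theorem mon_mem_spanUpTo_sup_irrSpan (hS : ∀ s ∈ S, Monic s) (w : Mon n X) :
    (mon w : Sha lam n X) ∈ spanUpTo S w ⊔ irrSpan S := by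
  induction w using WellFoundedLT.induction with
  | ind w ih =>
    by_cases hw : w ∈ Irr S
    · exact Submodule.mem_sup_right (Submodule.subset_span ⟨w, hw, rfl⟩)
    · rw [mem_irr_iff] at hw
      push Not at hw
      obtain ⟨g, hg⟩ := hw
      have h1 : g ∈ spanUpTo S w ⊔ irrSpan S :=
        Submodule.mem_sup_left (Submodule.subset_span ⟨w, hg, le_rfl⟩)
      have h2 : g - mon w ∈ spanUpTo S w ⊔ irrSpan S :=
        map_mem_of_mem_lower (T := LinearMap.id)
          (fun v hv => mem_sup_of_le (spanUpTo_mono hv.le) (ih v hv)) (hg.sub_mem_lower hS)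
      have := Submodule.sub_mem _ h1 h2
      rwa [sub_sub_cancel] at this

theorem mem_spanUpTo_lead_sup_irrSpan (hS : ∀ s ∈ S, Monic s) (f : Sha lam n X) :
    f ∈ spanUpTo S (lead f) ⊔ irrSpan S :=
  Sha.mem_of_forall_mon_mem fun v hv =>
    mem_sup_of_le (spanUpTo_mono (le_lead hv)) (mon_mem_spanUpTo_sup_irrSpan hS v)

/-- All normal elements led by `w` agree modulo `spanBelow S w`, so `f` is `c g₀` plus normal
elements below `w`. If `c ≠ 0` then `f̄ = w`; otherwise the bound decreases. -/
theorem IsGroebnerShirshov.exists_normalForm_lead (hGS : IsGroebnerShirshov S)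
    (hS : ∀ s ∈ S, Monic s) (w : Mon n X) :
    ∀ f ∈ spanUpTo S w, f ≠ 0 → ∃ g, NormalForm S (lead f) g := by
  induction w using WellFoundedLT.induction with
  | ind w ih =>
    intro f hf hf0
    have hbelow : f ∈ spanBelow S w → ∃ g, NormalForm S (lead f) g := by
      intro h
      obtain ⟨v, hv, h1⟩ := (eq_zero_or_exists_of_mem_spanBelow h).resolve_left hf0
      exact ih v hv f h1 hf0
    by_cases hw : ∃ g, NormalForm S w g
    · obtain ⟨g₀, hg₀⟩ := hw
      have hle : spanUpTo S w ≤ Submodule.span k {g₀} ⊔ spanBelow S w := by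
        refine Submodule.span_le.2 ?_
        rintro g ⟨v, hg, hv⟩
        rcases hv.lt_or_eq with hlt | rfl
        · exact Submodule.mem_sup_right (hg.mem_spanBelow hlt)
        · have h1 := hGS.normalForm_sub_mem hS hg g₀ hg₀
          rw [SetLike.mem_coe, ← add_sub_cancel g₀ g]
          exact Submodule.add_mem _ (Submodule.mem_sup_left (Submodule.mem_span_singleton_self g₀))
            (Submodule.mem_sup_right h1)
      obtain ⟨a, ha, b, hb, rfl⟩ := Submodule.mem_sup.1 (hle hf)
      obtain ⟨c, rfl⟩ := Submodule.mem_span_singleton.1 ha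
      by_cases hc : c = 0
      · refine hbelow ?_
        rwa [hc, zero_smul, zero_add]
      · have h2 : c • g₀ + b - c • mon w ∈ lower w := by
          rw [add_sub_right_comm, ← smul_sub]
          exact Submodule.add_mem _ (Submodule.smul_mem _ _ (hg₀.sub_mem_lower hS))
            (spanBelow_le_lower hS w hb)
        rw [(lead_eq_of_sub_mem_lower hc h2).2]
        exact ⟨g₀, hg₀⟩
    · refine hbelow ?_
      refine Submodule.span_le.2 ?_ hf
      rintro g ⟨v, hg, hv⟩
      rcases hv.lt_or_eq with hlt | rfl
      · exact hg.mem_spanBelow hlt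
      · exact absurd ⟨g, hg⟩ hw

theorem irrSpan_sup_drbIdeal (hS : ∀ s ∈ S, Monic s) :
    irrSpan S ⊔ (drbIdeal S).restrictScalars k = ⊤ := by
  rw [eq_top_iff]
  intro f _
  rw [sup_comm]
  exact mem_sup_of_le ((spanUpTo_le_normalSpan _).trans normalSpan_le_drbIdeal)
    (mem_spanUpTo_lead_sup_irrSpan hS f)

theorem isCompl_of_exists_normalForm (hS : ∀ s ∈ S, Monic s)
    (h : ∀ f ∈ drbIdeal S, f ≠ 0 → ∃ g, NormalForm S (lead f) g) :
    IsCompl (irrSpan S) ((drbIdeal S).restrictScalars k) := by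
  refine IsCompl.of_eq ?_ (irrSpan_sup_drbIdeal hS)
  rw [eq_bot_iff]
  rintro f ⟨h1, h2⟩
  rw [Submodule.mem_bot]
  by_contra hf
  obtain ⟨g, hg⟩ := h f h2 hf
  exact mem_irr_iff.1 (mem_irr_of_mem_irrSpan h1 (coords_lead_ne_zero hf)) g hg

/-- Division never exceeds `f̄`, and its irreducible remainder lies in both summands, hence is zero.
-/
theorem mem_spanUpTo_lead_of_disjoint (hS : ∀ s ∈ S, Monic s)
    (h : Disjoint (irrSpan S) ((drbIdeal S).restrictScalars k)) {f : Sha lam n X}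
    (hf : f ∈ drbIdeal S) : f ∈ spanUpTo S (lead f) := by
  obtain ⟨a, ha, b, hb, hab⟩ := Submodule.mem_sup.1 (mem_spanUpTo_lead_sup_irrSpan hS f)
  have hb' : b ∈ (drbIdeal S).restrictScalars k := by
    have h1 : a ∈ (drbIdeal S).restrictScalars k :=
      normalSpan_le_drbIdeal (spanUpTo_le_normalSpan _ ha)
    have h2 : f - a ∈ (drbIdeal S).restrictScalars k := Submodule.sub_mem _ hf h1
    rwa [← hab, add_sub_cancel_left] at h2
  rw [Submodule.disjoint_def.1 h b hb hb', add_zero] at hab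
  rwa [hab] at ha

theorem mem_spanBelow_of_disjoint (hS : ∀ s ∈ S, Monic s)
    (h : Disjoint (irrSpan S) ((drbIdeal S).restrictScalars k)) {f : Sha lam n X}
    (hf : f ∈ drbIdeal S) {w : Mon n X} (hw : f ∈ lower w) : f ∈ spanBelow S w := by
  by_cases h0 : f = 0
  · rw [h0]
    exact Submodule.zero_mem _
  · exact spanUpTo_le_spanBelow (lead_lt_of_mem_lower h0 hw) (mem_spanUpTo_lead_of_disjoint hS h hf)

/-- Every composition lies in `Id(S)`. An intersection or inclusion composition is moreover a
difference of two elements with the same leading term `w`, so it lies below `w`. -/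
theorem isGroebnerShirshov_of_disjoint (hS : ∀ s ∈ S, Monic s)
    (h : Disjoint (irrSpan S) ((drbIdeal S).restrictScalars k)) : IsGroebnerShirshov S where
  multiplication f hf _ u _ := trivial_iff.2 (mem_spanUpTo_lead_of_disjoint hS h
    (Ideal.mul_mem_right _ _ (subset_drbIdeal hf)))
  derivation f hf ℓ _ _ := trivial_iff.2 (mem_spanUpTo_lead_of_disjoint hS h
    (iterate_opD_mem_drbIdeal (subset_drbIdeal hf) ℓ))
  intersection f hf g hg u v w huvw := by
    refine (trivialBelow_iff hS).2 (mem_spanBelow_of_disjoint hS h ?_ ?_)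
    · exact Ideal.sub_mem _ (Ideal.mul_mem_right _ _ (subset_drbIdeal hf))
        (Ideal.mul_mem_left _ _ (subset_drbIdeal hg))
    · have h1 := mul_mon_sub_mem_lower (hS f hf) huvw.2.1
      have h2 := mul_mon_sub_mem_lower (hS g hg) (huvw.2.2.1.trans (mul_comm _ _))
      have h3 := Submodule.sub_mem _ h1 h2
      rwa [sub_sub_sub_cancel_right, mul_comm g] at h3
  inclusion f hf g hg q hq := by
    have hnf := NormalForm.of_subst q hg hq
    refine (trivialBelow_iff hS).2 (mem_spanBelow_of_disjoint hS h ?_ ?_)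
    · exact Ideal.sub_mem _ (subset_drbIdeal hf) hnf.mem_drbIdeal
    · have h3 := Submodule.sub_mem _ (hS f hf).sub_mem_lower (hnf.sub_mem_lower hS)
      rwa [sub_sub_sub_cancel_right] at h3

end Reduction

/-! ### The two wordings of (c) -/

section Quotient

variable {k : Type*} [CommRing k] {lam : k} {n : ℕ} {X : Type*}

theorem linearIndependent_mon :
    LinearIndependent k (fun w : Mon n X => (mon w : Sha lam n X)) := by
  have h : (fun w : Mon n X => (mon w : Sha lam n X)) =
      (Sha.coords.symm : (Mon n X →₀ k) ≃ₗ[k] Sha lam n X) ∘ fun w => Finsupp.single w 1 := rfl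
  rw [h]
  exact (Finsupp.linearIndependent_single_one k (Mon n X)).map' _ (LinearEquiv.ker _)

/-- As monomials are independent, their images are independent exactly when the kernel of the
quotient map meets their span trivially. The images span exactly when that span and the kernel
together give everything. -/
theorem isCompl_iff_quotient_basis (A : Set (Mon n X)) (I : Ideal (Sha lam n X)) :
    (LinearIndependent k (fun w : A => Ideal.Quotient.mk I (mon (w : Mon n X))) ∧
      Submodule.span k (Set.range fun w : A => Ideal.Quotient.mk I (mon (w : Mon n X))) = ⊤) ↔
    IsCompl (Submodule.span k ((fun w : Mon n X => (mon w : Sha lam n X)) '' A))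
      (I.restrictScalars k) := by
  let π : Sha lam n X →ₗ[k] Sha lam n X ⧸ I := (Ideal.Quotient.mkₐ k I).toLinearMap
  have hker : LinearMap.ker π = I.restrictScalars k := by
    ext f
    exact Ideal.Quotient.eq_zero_iff_mem
  have hrange : LinearMap.range π = ⊤ :=
    LinearMap.range_eq_top.2 Ideal.Quotient.mk_surjective
  have hli : LinearIndependent k (fun w : A => (mon (w : Mon n X) : Sha lam n X)) :=
    linearIndependent_mon.comp _ Subtype.val_injective
  have himage : (fun w : Mon n X => (mon w : Sha lam n X)) '' A =
      Set.range fun w : A => (mon (w : Mon n X) : Sha lam n X) := by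
    rw [Set.image_eq_range]
  have hfun : (fun w : A => Ideal.Quotient.mk I (mon (w : Mon n X))) =
      π ∘ fun w : A => (mon (w : Mon n X) : Sha lam n X) := rfl
  rw [hfun, himage, isCompl_iff, ← hker]
  refine and_congr ⟨fun h => ?_, fun h => hli.map h⟩ ?_
  · rw [Submodule.disjoint_def]
    intro f hf hf0
    rw [← Finsupp.range_linearCombination] at hf
    obtain ⟨c, rfl⟩ := hf
    rw [LinearMap.mem_ker, Finsupp.apply_linearCombination] at hf0
    rw [linearIndependent_iff.1 h c hf0, map_zero]
  · rw [Set.range_comp, ← Submodule.map_span, LinearMap.map_eq_top_iff hrange, codisjoint_iff]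

end Quotient

end DRB

theorem mainTheorem2 {k : Type*} [CommRing k] (lam : k) (n : ℕ) {X : Type*} [LinearOrder X]
    [WellFoundedLT X] (S : Set (DRB.Sha lam n X)) (hS : ∀ s ∈ S, DRB.Monic s) :
    List.TFAE [
      DRB.IsGroebnerShirshov S,
      ∀ f ∈ DRB.drbIdeal S, f ≠ 0 →
        ∃ (q : DRB.StarMon n X) (s : DRB.Sha lam n X), s ∈ S ∧ DRB.Normal q s ∧
          DRB.toBracketed (DRB.lead f) = q.subst (DRB.lead s),
      LinearIndependent k (fun w : DRB.Irr S =>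
          Ideal.Quotient.mk (DRB.drbIdeal S) (DRB.mon (w : DRB.Mon n X))) ∧
        Submodule.span k (Set.range fun w : DRB.Irr S =>
          Ideal.Quotient.mk (DRB.drbIdeal S) (DRB.mon (w : DRB.Mon n X))) = ⊤,
      IsCompl (Submodule.span k ((fun w : DRB.Mon n X => (DRB.mon w : DRB.Sha lam n X)) ''
          DRB.Irr S)) ((DRB.drbIdeal S).restrictScalars k)] := by
  tfae_have 1 → 2 := by
    intro hGS f hf hf0
    have hf' : f ∈ DRB.normalSpan S := hGS.drbIdeal_eq ▸ hf
    obtain ⟨v, hv⟩ := DRB.exists_mem_spanUpTo_of_mem_normalSpan hf'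
    exact DRB.exists_normalForm_iff.1 (hGS.exists_normalForm_lead hS v f hv hf0)
  tfae_have 2 → 4 := fun h => DRB.isCompl_of_exists_normalForm hS fun f hf hf0 =>
    DRB.exists_normalForm_iff.2 (h f hf hf0)
  tfae_have 3 ↔ 4 := DRB.isCompl_iff_quotient_basis _ _
  tfae_have 4 → 1 := fun h => DRB.isGroebnerShirshov_of_disjoint hS h.disjoint
  tfae_finish
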